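/- Let $(r_n)_{n\ge 0}$ be integers with $r_n\ge 2$ and, for each $n\ge 0$, let $s_n=(s_n(0),\dots,s_n(r_n-2))$ be an $(r_n-1)$-tuple of non-negative integers. The rank-one transformation with parameters $(r_n)$, $(s_n)$ is obtained by cutting and stacking. Start with the column $C_0$ consisting of the single interval $[0,1)$. Given the column $C_n$, which is a finite stack of $h_n$ disjoint left-closed, right-open intervals (levels) of equal length, cut each level into $r_n$ subintervals of equal length, which cuts $C_n$ into $r_n$ subcolumns, numbered $0,\dots,r_n-1$ from left to right. Put $s_n(i)$ new disjoint intervals (spacers) of the same length as these subintervals on top of the $i$-th subcolumn for $0\le i\le r_n-2$, and none on top of the last one. Then stack every subcolumn on top of the one to its left to form $C_{n+1}$. Thus $h_0=1$ and $h_{n+1}=r_nh_n+\sum_{i=0}^{r_n-2}s_n(i)$. The transformation acts on the union of all levels, with Lebesgue measure, by translating every level of every column, except the top one, onto the level above it. This defines, up to null sets, an invertible measure-preserving transformation. A measure-preserving transformation that is isomorphic to this one is called a rank-one transformation with parameters $(r_n)$, $(s_n)$. Here and below, an isomorphism of measure-preserving systems is a measure-preserving map, invertible modulo null sets with measure-preserving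 inverse, that intertwines the two transformations almost everywhere. Suppose that the parameters are partially bounded: there are integers $R>0$, $S>0$ and $N_0$ such that for all $n\ge N_0$ 1. $r_n<R$; 2. $|s_n(i)-s_n(j)|<S$ for $0\le i,j<r_n-1$; 3. $s_n(i)\ge h_n$ for $0\le i<r_n-1$. **Theorem.** Let $T$ be a rank-one transformation with partially bounded parameters $(r_n)$, $(s_n)$. Then $T$ is isomorphic to $T^{-1}$ if and only if there is $N\in\mathbb N$ such that for all $n\ge N$ the tuple $s_n$ equals its reversal, that is, $s_n(i)=s_n(r_n-2-i)$ for $0\le i\le r_n-2$. -/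

import Mathlib

open MeasureTheory

namespace RankOne

/-! Cutting and stacking with cutting parameters `r` and spacer parameters `s`: at stage `n` every
level is cut into `r n` pieces and `s n i` spacers are put above the `i`-th subcolumn,
`0 ≤ i < r n`. Values `s n i` with `i ≥ r n` are never used. -/

/-- The height `h_n` of the column `C_n`. -/
def height (r : ℕ → ℕ) (s : ℕ → ℕ → ℕ) : ℕ → ℕ
  | 0 => 1
  | n + 1 => r n * height r s n + ∑ i ∈ Finset.range (r n), s n i

/-- The common length of the levels of `C_n`. -/
noncomputable def width (r : ℕ → ℕ) (n : ℕ) : ℝ :=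
  ∏ k ∈ Finset.range n, (r k : ℝ)⁻¹

/-- The position in the column `C_{n+1}` at which the `i`-th subcolumn of `C_n` starts. -/
def subcolumnStart (r : ℕ → ℕ) (s : ℕ → ℕ → ℕ) (n i : ℕ) : ℕ :=
  ∑ k ∈ Finset.range i, (height r s n + s n k)

/-- `Level r s n j a` says that the `j`-th level (from the bottom, starting with `0`) of the column
`C_n` is the interval `[a, a + width r n)`. The column `C_0` is the single interval `[0, 1)`. The
levels of `C_n` fill `[0, height r s n * width r n)`; the spacers added at stage `n` are the
consecutive intervals of length `width r (n + 1)` to the right of it. -/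
inductive Level (r : ℕ → ℕ) (s : ℕ → ℕ → ℕ) : ℕ → ℕ → ℝ → Prop
  /-- the base of the construction -/
  | base : Level r s 0 0 0
  /-- the `i`-th piece, from the left, of the `j`-th level of `C_n` -/
  | piece (n j i : ℕ) (a : ℝ) (hi : i < r n) (ha : Level r s n j a) :
      Level r s (n + 1) (subcolumnStart r s n i + j) (a + i * width r (n + 1))
  /-- the `k`-th spacer above the `i`-th subcolumn of `C_n` -/
  | spacer (n i k : ℕ) (hi : i < r n) (hk : k < s n i) :
      Level r s (n + 1) (subcolumnStart r s n i + height r s n + k)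
        (height r s n * width r n
          + ((∑ l ∈ Finset.range i, s n l : ℕ) + k : ℝ) * width r (n + 1))

/-- The union of all the levels of all the columns. -/
def space (r : ℕ → ℕ) (s : ℕ → ℕ → ℕ) : Set ℝ :=
  {x | ∃ n j a, Level r s n j a ∧ x ∈ Set.Ico a (a + width r n)}

/-- Lebesgue measure on the union of the levels. -/
noncomputable def measure (r : ℕ → ℕ) (s : ℕ → ℕ → ℕ) : Measure ℝ :=
  volume.restrict (space r s)

/-- Some column `C_n` sends `x` to `y`: the point `x` lies in a level of `C_n` below the top one,
and `y` is its image under the translation onto the next level. -/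
def StepsTo (r : ℕ → ℕ) (s : ℕ → ℕ → ℕ) (x y : ℝ) : Prop :=
  ∃ n j a b, Level r s n j a ∧ Level r s n (j + 1) b ∧
    x ∈ Set.Ico a (a + width r n) ∧ y = x - a + b

open Classical in
/-- The cutting-and-stacking transformation: the common extension of the partial transformations
given by the columns. The columns extend one another, so the `y` below is unique; it exists for
every point of `space r s`. Outside this set the value is irrelevant. -/
noncomputable def map (r : ℕ → ℕ) (s : ℕ → ℕ → ℕ) (x : ℝ) : ℝ :=
  if h : ∃ y, StepsTo r s x y then h.choose else x

/-- Isomorphism of measure-preserving systems, modulo null sets. -/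
def Isomorphic {X Y : Type*} [MeasurableSpace X] [MeasurableSpace Y]
    (μ : Measure X) (T : X → X) (ν : Measure Y) (S : Y → Y) : Prop :=
  ∃ (φ : X → Y) (ψ : Y → X), MeasurePreserving φ μ ν ∧ MeasurePreserving ψ ν μ ∧
    (∀ᵐ x ∂μ, ψ (φ x) = x) ∧ (∀ᵐ y ∂ν, φ (ψ y) = y) ∧ ∀ᵐ x ∂μ, φ (T x) = S (φ x)

/-- `S` is the inverse of the transformation `T`, modulo null sets. -/
def IsInverse {X : Type*} [MeasurableSpace X] (μ : Measure X) (T S : X → X) : Prop :=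
  MeasurePreserving S μ μ ∧ (∀ᵐ x ∂μ, S (T x) = x) ∧ ∀ᵐ x ∂μ, T (S x) = x

/-- `T` is isomorphic to its inverse (which is unique modulo null sets). -/
def IsomorphicToInverse {X : Type*} [MeasurableSpace X] (μ : Measure X) (T : X → X) : Prop :=
  ∃ S : X → X, IsInverse μ T S ∧ Isomorphic μ T μ S

/-- `T` is a rank-one transformation with cutting parameters `r` and spacer parameters `s`: up to
isomorphism (the intervals used as spacers may be chosen at will), it is the transformation
obtained from them by cutting and stacking. -/
def HasParameters {X : Type*} [MeasurableSpace X] (μ : Measure X) (T : X → X)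
    (r : ℕ → ℕ) (s : ℕ → ℕ → ℕ) : Prop :=
  MeasurePreserving T μ μ ∧ (∀ n, 2 ≤ r n) ∧ Isomorphic μ T (measure r s) (map r s)

/-- The parameters `r`, `s` are partially bounded. As no spacers are put on a last subcolumn,
`height r s n` is the length of the `n`-th rank-one word. -/
def PartiallyBounded (r : ℕ → ℕ) (s : ℕ → ℕ → ℕ) : Prop :=
  (∀ n, s n (r n - 1) = 0) ∧
  ∃ R S N : ℕ, 0 < R ∧ 0 < S ∧ ∀ n, N ≤ n →
    r n < R ∧
    (∀ i j, i < r n - 1 → j < r n - 1 → |(s n i : ℤ) - (s n j : ℤ)| < S) ∧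
    (∀ i, i < r n - 1 → height r s n ≤ s n i)

end RankOne

namespace RankOne

variable {r : ℕ → ℕ} {s : ℕ → ℕ → ℕ}

/-! ### Heights, widths and subcolumns -/

/-! Write `h_n`, `w_n` for the height and width of `C_n`, and `M` for `map r s`. If the spacers are
palindromic from stage `N` on, each `C_n` with `n ≥ N` can be turned upside down, every level being
also flipped left to right. Piece `i` then goes to piece `r n - 1 - i`, so these reflections agree
for all `n` and glue to an involution conjugating `M` to its inverse
(`PalindromicFrom.exists_conjugation`). Conversely, let `φ` reverse the orbits, let `A` be the base
of `C_N`, and take `n` large. Copies of `C_n` in later columns are separated by at least `h_n`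
spacers, so the image under `φ` of one passage through `C_n` meets at most one copy, and level `c`
can only go to level `o - c` for an offset `o` (`ReversesOrbit.exists_offset`). The image of `A` is
nearly a union of levels of `C_n`, indexed by a set `D` of about as many elements as the set `C` of
levels making up `A`. Hence `o - c` lies in `D` for most `c` in `C`. Two offsets would put two
different reflections of most of `C` into `D`; but a translate of `C` misses a fixed fraction of `C`
(`SparseFrom.card_bases_le`), so `D` would be too large. Thus all good passages share one offset
(`exists_common_offset`). By Markov's inequality some passage through `C_{n+1}` consists of `r n`
good passages through `C_n`. Their images lie in a single copy of `C_{n+1}`, in reverse order and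
with equal offsets, so the gaps between the subcolumns read the same backwards
(`ReversesOrbit.palindrome`). -/

theorem subcolumnStart_zero (n : ℕ) : subcolumnStart r s n 0 = 0 := by
  simp [subcolumnStart]

theorem subcolumnStart_succ (n i : ℕ) :
    subcolumnStart r s n (i + 1) = subcolumnStart r s n i + (height r s n + s n i) := by
  simp [subcolumnStart, Finset.sum_range_succ]

theorem height_succ (n : ℕ) : height r s (n + 1) = subcolumnStart r s n (r n) := by
  simp [height, subcolumnStart, Finset.sum_add_distrib]

theorem subcolumnStart_mono (n : ℕ) : Monotone (subcolumnStart r s n) :=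
  monotone_nat_of_le_succ fun i => by rw [subcolumnStart_succ]; omega

theorem subcolumnStart_add_le {n i i' : ℕ} (h : i < i') :
    subcolumnStart r s n i + (height r s n + s n i) ≤ subcolumnStart r s n i' := by
  rw [← subcolumnStart_succ]
  exact subcolumnStart_mono n h

theorem eq_of_subcolumnStart_add_eq {n i i' u u' : ℕ}
    (h : subcolumnStart r s n i + u = subcolumnStart r s n i' + u')
    (hu : u < height r s n + s n i) (hu' : u' < height r s n + s n i') : i = i' := by
  rcases lt_trichotomy i i' with hi | hi | hi
  · have := subcolumnStart_add_le (r := r) (s := s) (n := n) hi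
    omega
  · exact hi
  · have := subcolumnStart_add_le (r := r) (s := s) (n := n) hi
    omega

theorem exists_subcolumnStart_add {n J : ℕ} :
    ∀ {m : ℕ}, J < subcolumnStart r s n m →
      ∃ i < m, ∃ u < height r s n + s n i, J = subcolumnStart r s n i + u
  | 0, h => by simp [subcolumnStart_zero] at h
  | m + 1, h => by
    rcases lt_or_ge J (subcolumnStart r s n m) with h' | h'
    · obtain ⟨i, hi, u, hu, e⟩ := exists_subcolumnStart_add h'
      exact ⟨i, by omega, u, hu, e⟩
    · rw [subcolumnStart_succ] at h
      exact ⟨m, by omega, J - subcolumnStart r s n m, by omega, by omega⟩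

theorem subcolumnStart_add_lt {n i u : ℕ} (hi : i < r n) (hu : u < height r s n + s n i) :
    subcolumnStart r s n i + u < height r s (n + 1) := by
  have := subcolumnStart_add_le (r := r) (s := s) (n := n) hi
  rw [height_succ]
  omega

theorem two_mul_height_le (hr : ∀ n, 2 ≤ r n) (n : ℕ) :
    2 * height r s n ≤ height r s (n + 1) := by
  rw [height]
  have := Nat.mul_le_mul_right (height r s n) (hr n)
  omega

theorem lt_height (hr : ∀ n, 2 ≤ r n) : ∀ n, n < height r s n
  | 0 => by simp [height]
  | n + 1 => by
    have := two_mul_height_le (s := s) hr n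
    have := lt_height hr n
    omega

theorem height_mono (hr : ∀ n, 2 ≤ r n) : Monotone (height r s) :=
  monotone_nat_of_le_succ fun n => by have := two_mul_height_le (s := s) hr n; omega

theorem width_pos (hr : ∀ n, 2 ≤ r n) (n : ℕ) : 0 < width r n :=
  Finset.prod_pos fun k _ => by have := hr k; positivity

theorem mul_width_succ (hr : ∀ n, 2 ≤ r n) (n : ℕ) : r n * width r (n + 1) = width r n := by
  have := hr n
  have : (r n : ℝ) ≠ 0 := by positivity
  rw [width, Finset.prod_range_succ, ← width]
  field_simp

theorem tendsto_width (hr : ∀ n, 2 ≤ r n) :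
    Filter.Tendsto (width r) Filter.atTop (nhds 0) := by
  refine squeeze_zero (fun n => (width_pos hr n).le) (g := fun n => (1 / 2 : ℝ) ^ n) (fun n => ?_)
    (tendsto_pow_atTop_nhds_zero_of_lt_one (by norm_num) (by norm_num))
  rw [← Finset.card_range n, ← Finset.prod_const, Finset.card_range]
  refine Finset.prod_le_prod (fun _ _ => by positivity) fun k _ => ?_
  rw [one_div]
  exact inv_anti₀ (by norm_num) (by exact_mod_cast hr k)

theorem exists_width_eq_ratCast (n : ℕ) : ∃ q : ℚ, width r n = q :=
  ⟨∏ k ∈ Finset.range n, (r k : ℚ)⁻¹, by simp [width]⟩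

/-! ### The levels as intervals -/

theorem level_zero_iff {j : ℕ} {a : ℝ} : Level r s 0 j a ↔ j = 0 ∧ a = 0 := by
  constructor
  · rintro ⟨⟩
    exact ⟨rfl, rfl⟩
  · rintro ⟨rfl, rfl⟩
    exact .base

theorem level_succ_iff {n J : ℕ} {a : ℝ} :
    Level r s (n + 1) J a ↔
      (∃ j i b, i < r n ∧ Level r s n j b ∧ J = subcolumnStart r s n i + j ∧
        a = b + i * width r (n + 1)) ∨
      ∃ i k, i < r n ∧ k < s n i ∧ J = subcolumnStart r s n i + height r s n + k ∧
        a = height r s n * width r n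
          + ((∑ l ∈ Finset.range i, s n l : ℕ) + k : ℝ) * width r (n + 1) := by
  constructor
  · intro h
    cases h with
    | piece n j i b hi hb => exact .inl ⟨j, i, b, hi, hb, rfl, rfl⟩
    | spacer n i k hi hk => exact .inr ⟨i, k, hi, hk, rfl, rfl⟩
  · rintro (⟨j, i, b, hi, hb, rfl, rfl⟩ | ⟨i, k, hi, hk, rfl, rfl⟩)
    · exact .piece n j i b hi hb
    · exact .spacer n i k hi hk

theorem Level.lt_height {n j : ℕ} {a : ℝ} (h : Level r s n j a) : j < height r s n := by
  induction h with
  | base => simp [height]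
  | piece n j i a hi _ ih => exact subcolumnStart_add_lt hi (by omega)
  | spacer n i k hi hk => rw [add_assoc]; exact subcolumnStart_add_lt hi (by omega)

theorem exists_level : ∀ {n j : ℕ}, j < height r s n → ∃ a, Level r s n j a
  | 0, j, h => by
    obtain rfl : j = 0 := by simpa [height] using h
    exact ⟨0, .base⟩
  | n + 1, J, h => by
    rw [height_succ] at h
    obtain ⟨i, hi, u, hu, rfl⟩ := exists_subcolumnStart_add h
    rcases lt_or_ge u (height r s n) with h' | h'
    · obtain ⟨a, ha⟩ := exists_level h'
      exact ⟨_, .piece n u i a hi ha⟩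
    · obtain ⟨k, rfl⟩ := Nat.exists_eq_add_of_le h'
      rw [← add_assoc]
      exact ⟨_, .spacer n i k hi (by omega)⟩

theorem Level.left_unique : ∀ {n j : ℕ} {a a' : ℝ}, Level r s n j a → Level r s n j a' → a = a'
  | 0, j, a, a', h, h' => by
    rw [level_zero_iff] at h h'
    rw [h.2, h'.2]
  | n + 1, J, a, a', h, h' => by
    rw [level_succ_iff] at h h'
    rcases h with ⟨j, i, b, hi, hb, e, rfl⟩ | ⟨i, k, hi, hk, e, rfl⟩ <;>
    rcases h' with ⟨j', i', b', hi', hb', e', rfl⟩ | ⟨i', k', hi', hk', e', rfl⟩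
    · have h1 := hb.lt_height
      have h2 := hb'.lt_height
      obtain rfl := eq_of_subcolumnStart_add_eq (e.symm.trans e') (by omega) (by omega)
      obtain rfl : j = j' := by omega
      rw [Level.left_unique hb hb']
    · have h1 := hb.lt_height
      rw [add_assoc] at e'
      obtain rfl := eq_of_subcolumnStart_add_eq (e.symm.trans e') (by omega) (by omega)
      omega
    · have h2 := hb'.lt_height
      rw [add_assoc] at e
      obtain rfl := eq_of_subcolumnStart_add_eq (e.symm.trans e') (by omega) (by omega)
      omega
    · rw [add_assoc] at e e'
      obtain rfl := eq_of_subcolumnStart_add_eq (e.symm.trans e') (by omega) (by omega)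
      obtain rfl : k = k' := by omega
      rfl

/-- The left endpoints of the levels of `C_n` are multiples of the width, and the multiple
determines the level. -/
theorem exists_leftIndex (hr : ∀ n, 2 ≤ r n) :
    ∀ n : ℕ, ∃ q : ℕ → ℕ, Set.InjOn q (Set.Iio (height r s n)) ∧
      (∀ j < height r s n, q j < height r s n) ∧ ∀ j a, Level r s n j a → a = q j * width r n
  | 0 => by
    refine ⟨id, Set.injOn_id _, fun j hj => hj, fun j a h => ?_⟩
    rw [level_zero_iff] at h
    simp [h.1, h.2]
  | n + 1 => by
    obtain ⟨q, hq, hqlt, hqa⟩ := exists_leftIndex hr n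
    have hw := width_pos hr (n + 1)
    -- In units of the new width, pieces of old levels fill the indices below `r n * height r s n`,
    -- and the spacers follow in order of creation.
    have key : ∀ J a, Level r s (n + 1) J a → ∃ v : ℕ, a = v * width r (n + 1) ∧
        ((∃ j i, j < height r s n ∧ i < r n ∧ J = subcolumnStart r s n i + j ∧
          v = r n * q j + i) ∨
        ∃ i k, i < r n ∧ k < s n i ∧ J = subcolumnStart r s n i + height r s n + k ∧
          v = r n * height r s n + (∑ l ∈ Finset.range i, s n l + k)) := by
      intro J a h
      rw [level_succ_iff] at h
      rcases h with ⟨j, i, b, hi, hb, e, rfl⟩ | ⟨i, k, hi, hk, e, rfl⟩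
      · refine ⟨_, ?_, .inl ⟨j, i, hb.lt_height, hi, e, rfl⟩⟩
        rw [hqa j b hb, ← mul_width_succ hr n]
        push_cast
        ring
      · refine ⟨_, ?_, .inr ⟨i, k, hi, hk, e, rfl⟩⟩
        rw [← mul_width_succ hr n]
        push_cast
        ring
    have ex : ∀ J, ∃ v : ℕ, J < height r s (n + 1) → Level r s (n + 1) J (v * width r (n + 1)) ∧
        ((∃ j i, j < height r s n ∧ i < r n ∧ J = subcolumnStart r s n i + j ∧
          v = r n * q j + i) ∨
        ∃ i k, i < r n ∧ k < s n i ∧ J = subcolumnStart r s n i + height r s n + k ∧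
          v = r n * height r s n + (∑ l ∈ Finset.range i, s n l + k)) := by
      intro J
      by_cases hJ : J < height r s (n + 1)
      · obtain ⟨a, ha⟩ := exists_level hJ
        obtain ⟨v, hv, h⟩ := key J a ha
        exact ⟨v, fun _ => ⟨hv ▸ ha, h⟩⟩
      · exact ⟨0, fun h => absurd h hJ⟩
    choose v hv using ex
    have hpart : ∀ {i k}, i < r n → k < s n i → ∀ {i'}, i < i' →
        ∑ l ∈ Finset.range i, s n l + k < ∑ l ∈ Finset.range i', s n l := by
      intro i k _ hk i' hi'
      have : ∑ l ∈ Finset.range (i + 1), s n l ≤ ∑ l ∈ Finset.range i', s n l :=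
        Finset.sum_le_sum_of_subset (Finset.range_mono hi')
      rw [Finset.sum_range_succ] at this
      omega
    have hlow : ∀ {j i}, j < height r s n → i < r n →
        r n * q j + i < r n * height r s n := by
      intro j i hj hi
      have := Nat.mul_le_mul_left (r n) (Nat.succ_le_of_lt (hqlt j hj))
      rw [Nat.mul_succ] at this
      omega
    refine ⟨v, fun J hJ J' hJ' e => ?_, fun J hJ => ?_, fun J a h => ?_⟩
    · obtain ⟨-, h⟩ := hv J hJ
      obtain ⟨-, h'⟩ := hv J' hJ'
      rcases h with ⟨j, i, hj, hi, e1, e2⟩ | ⟨i, k, hi, hk, e1, e2⟩ <;>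
      rcases h' with ⟨j', i', hj', hi', e1', e2'⟩ | ⟨i', k', hi', hk', e1', e2'⟩
      · rw [e2, e2'] at e
        have hr0 : 0 < r n := by omega
        have e3 : q j = q j' := by
          have := congrArg (· / r n) e
          simpa [Nat.mul_add_div hr0, Nat.div_eq_of_lt hi, Nat.div_eq_of_lt hi'] using this
        obtain rfl := hq hj hj' e3
        obtain rfl : i = i' := by omega
        rw [e1, e1']
      · have := hlow hj hi
        omega
      · have := hlow hj' hi'
        omega
      · have : i = i' := by
          rcases lt_trichotomy i i' with h | h | h
          · have := hpart hi hk h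
            omega
          · exact h
          · have := hpart hi' hk' h
            omega
        subst this
        obtain rfl : k = k' := by omega
        rw [e1, e1']
    · obtain ⟨-, h⟩ := hv J hJ
      rw [height]
      rcases h with ⟨j, i, hj, hi, e1, e2⟩ | ⟨i, k, hi, hk, e1, e2⟩
      · have := hlow hj hi
        omega
      · have := hpart hi hk hi
        omega
    · exact h.left_unique (hv J h.lt_height).1

/-- The `j`-th level of `C_n`, empty if there is none. -/
def levelSet (r : ℕ → ℕ) (s : ℕ → ℕ → ℕ) (n j : ℕ) : Set ℝ :=
  {x | ∃ a, Level r s n j a ∧ x ∈ Set.Ico a (a + width r n)}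

theorem Level.levelSet_eq {n j : ℕ} {a : ℝ} (h : Level r s n j a) :
    levelSet r s n j = Set.Ico a (a + width r n) := by
  ext x
  constructor
  · rintro ⟨b, hb, hx⟩
    rwa [h.left_unique hb]
  · exact fun hx => ⟨a, h, hx⟩

theorem levelSet_eq_empty {n j : ℕ} (h : height r s n ≤ j) : levelSet r s n j = ∅ := by
  ext x
  simp only [levelSet, Set.mem_ofPred_eq, Set.mem_empty_iff_false, iff_false]
  rintro ⟨a, ha, -⟩
  have := ha.lt_height
  omega

theorem lt_height_of_mem {n j : ℕ} {x : ℝ} (h : x ∈ levelSet r s n j) : j < height r s n := by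
  obtain ⟨a, ha, -⟩ := h
  exact ha.lt_height

theorem measurableSet_levelSet (n j : ℕ) : MeasurableSet (levelSet r s n j) := by
  rcases lt_or_ge j (height r s n) with h | h
  · obtain ⟨a, ha⟩ := exists_level h
    rw [ha.levelSet_eq]
    exact measurableSet_Ico
  · rw [levelSet_eq_empty h]
    exact .empty

theorem volume_levelSet {n j : ℕ} (h : j < height r s n) :
    volume (levelSet r s n j) = ENNReal.ofReal (width r n) := by
  obtain ⟨a, ha⟩ := exists_level h
  rw [ha.levelSet_eq, Real.volume_Ico]
  congr 1
  ring

theorem eq_of_mem_levelSet (hr : ∀ n, 2 ≤ r n) {n j j' : ℕ} {x : ℝ} (h : x ∈ levelSet r s n j)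
    (h' : x ∈ levelSet r s n j') : j = j' := by
  obtain ⟨q, hq, -, hqa⟩ := exists_leftIndex (s := s) hr n
  obtain ⟨a, ha, hx⟩ := h
  obtain ⟨a', ha', hx'⟩ := h'
  have hw := width_pos hr n
  refine hq ha.lt_height ha'.lt_height ?_
  rw [hqa j a ha, Set.mem_Ico] at hx
  rw [hqa j' a' ha', Set.mem_Ico] at hx'
  have h1 : (q j : ℝ) < q j' + 1 := by nlinarith
  have h2 : (q j' : ℝ) < q j + 1 := by nlinarith
  norm_cast at h1 h2
  omega

/-- Rational endpoints make every irrational point interior to its levels, so reflected half-open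
intervals cause trouble only on a null set. -/
theorem Level.exists_eq_ratCast (hr : ∀ n, 2 ≤ r n) {n j : ℕ} {a : ℝ} (h : Level r s n j a) :
    ∃ q : ℚ, a = q := by
  obtain ⟨v, -, -, hv⟩ := exists_leftIndex (s := s) hr n
  obtain ⟨w, hw⟩ := exists_width_eq_ratCast (r := r) n
  exact ⟨v j * w, by rw [hv j a h, hw]; push_cast; rfl⟩

theorem space_eq : space r s = ⋃ n, ⋃ j, levelSet r s n j := by
  ext x
  simp [space, levelSet]

theorem measurableSet_space : MeasurableSet (space r s) := by
  rw [space_eq]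
  exact .iUnion fun n => .iUnion fun j => measurableSet_levelSet n j

theorem levelSet_subset_space (n j : ℕ) : levelSet r s n j ⊆ space r s := by
  rw [space_eq]
  exact Set.subset_iUnion₂ (s := fun n j => levelSet r s n j) n j

/-! ### Passing to the next column -/

theorem levelSet_piece_subset (hr : ∀ n, 2 ≤ r n) {n i j : ℕ} (hi : i < r n)
    (hj : j < height r s n) :
    levelSet r s (n + 1) (subcolumnStart r s n i + j) ⊆ levelSet r s n j := by
  obtain ⟨a, ha⟩ := exists_level hj
  rw [ha.levelSet_eq, (Level.piece n j i a hi ha).levelSet_eq, ← mul_width_succ hr n]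
  have hw := width_pos hr (n + 1)
  have h1 : (i : ℝ) + 1 ≤ r n := by exact_mod_cast hi
  apply Set.Ico_subset_Ico
  · have : 0 ≤ (i : ℝ) * width r (n + 1) := by positivity
    linarith
  · nlinarith

theorem exists_mem_levelSet_succ (hr : ∀ n, 2 ≤ r n) {n j : ℕ} {x : ℝ}
    (h : x ∈ levelSet r s n j) :
    ∃ i < r n, x ∈ levelSet r s (n + 1) (subcolumnStart r s n i + j) := by
  obtain ⟨a, ha, h1, h2⟩ := h
  have hw := width_pos hr (n + 1)
  have h0 : 0 ≤ (x - a) / width r (n + 1) := div_nonneg (by linarith) hw.le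
  rw [← mul_width_succ hr n] at h2
  have hi : ⌊(x - a) / width r (n + 1)⌋₊ < r n := by
    rw [Nat.floor_lt h0, div_lt_iff₀ hw]
    linarith
  refine ⟨_, hi, _, .piece n j _ a hi ha, ?_, ?_⟩
  · have := Nat.floor_le h0
    rw [le_div_iff₀ hw] at this
    linarith
  · have := Nat.lt_floor_add_one ((x - a) / width r (n + 1))
    rw [div_lt_iff₀ hw] at this
    linarith

theorem exists_mem_levelSet_of_le (hr : ∀ n, 2 ≤ r n) {m n j : ℕ} (hmn : m ≤ n) {x : ℝ}
    (h : x ∈ levelSet r s m j) : ∃ j', x ∈ levelSet r s n j' := by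
  induction n, hmn using Nat.le_induction with
  | base => exact ⟨j, h⟩
  | succ n _ ih =>
    obtain ⟨j', h'⟩ := ih
    obtain ⟨i, -, hx⟩ := exists_mem_levelSet_succ hr h'
    exact ⟨_, hx⟩

/-- A point in the rightmost subcolumn from some stage on would lie in intervals shrinking to
their common right end, so every point gets away from the tops of the columns. -/
theorem exists_subcolumn_lt (hr : ∀ n, 2 ≤ r n) {m j : ℕ} {x : ℝ} (h : x ∈ levelSet r s m j) :
    ∃ n, m ≤ n ∧ ∃ j' i, i + 1 < r n ∧ j' < height r s n ∧
      x ∈ levelSet r s (n + 1) (subcolumnStart r s n i + j') := by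
  by_contra! hcon
  obtain ⟨a, ha, hx⟩ := h
  -- Always taking the last piece keeps the right endpoint fixed while the width tends to zero.
  have key : ∀ n, m ≤ n → ∃ j' a', Level r s n j' a' ∧ a' ≤ x ∧ a' + width r n = a + width r m := by
    intro n hn
    induction n, hn using Nat.le_induction with
    | base => exact ⟨j, a, ha, hx.1, rfl⟩
    | succ n hn ih =>
      obtain ⟨j', a', ha', h1, h2⟩ := ih
      have hx' : x ∈ levelSet r s n j' := ⟨a', ha', h1, by rw [h2]; exact hx.2⟩
      obtain ⟨i, hi, hxi⟩ := exists_mem_levelSet_succ hr hx'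
      have hi' : i + 1 = r n := by
        by_contra hne
        exact hcon n hn j' i (by omega) ha'.lt_height hxi
      have hp := Level.piece n j' i a' hi ha'
      rw [hp.levelSet_eq] at hxi
      refine ⟨_, _, hp, hxi.1, ?_⟩
      rw [← h2, ← mul_width_succ hr n, ← hi']
      push_cast
      ring
  have hlim : a + width r m - x ≤ 0 := by
    refine ge_of_tendsto (tendsto_width hr) ?_
    filter_upwards [Filter.eventually_ge_atTop m] with n hn
    obtain ⟨j', a', -, h1, h2⟩ := key n hn
    linarith
  have := hx.2
  linarith

/-- Above a point in a subcolumn other than the last lies a full further subcolumn, of more than `n`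
levels. Any finite orbit segment can therefore be read inside one column. -/
theorem exists_mem_levelSet_add_lt (hr : ∀ n, 2 ≤ r n) {x : ℝ} (hx : x ∈ space r s) (m t : ℕ) :
    ∃ n, m ≤ n ∧ ∃ j, x ∈ levelSet r s n j ∧ j + t < height r s n := by
  rw [space_eq] at hx
  simp only [Set.mem_iUnion] at hx
  obtain ⟨k, j, h⟩ := hx
  obtain ⟨l, hl⟩ := exists_mem_levelSet_of_le hr (le_max_left k (max m t)) h
  obtain ⟨n, hn, j', i, hi, hj', hx⟩ := exists_subcolumn_lt hr hl
  refine ⟨n + 1, by omega, _, hx, ?_⟩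
  have h1 := subcolumnStart_add_le (r := r) (s := s) (n := n) (Nat.lt_succ_self i)
  have h2 := subcolumnStart_add_le (r := r) (s := s) (n := n) hi
  have h3 := lt_height (s := s) hr n
  rw [height_succ]
  simp only [Nat.succ_eq_add_one] at h1
  omega

/-! ### The transformation on the levels -/

/-- Two consecutive levels are cut alike and their `i`-th pieces remain consecutive, so the
displacement survives in every later column. This makes `map` well defined. -/
theorem StepsTo.lift (hr : ∀ n, 2 ≤ r n) {m n j : ℕ} {a b x : ℝ} (hmn : m ≤ n)
    (ha : Level r s m j a) (hb : Level r s m (j + 1) b) (hx : x ∈ Set.Ico a (a + width r m)) :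
    ∃ j' a' b', Level r s n j' a' ∧ Level r s n (j' + 1) b' ∧ x ∈ Set.Ico a' (a' + width r n) ∧
      x - a + b = x - a' + b' := by
  induction n, hmn using Nat.le_induction with
  | base => exact ⟨j, a, b, ha, hb, hx, rfl⟩
  | succ n _ ih =>
    obtain ⟨j', a', b', ha', hb', hx', e⟩ := ih
    obtain ⟨i, hi, h⟩ := exists_mem_levelSet_succ hr ⟨a', ha', hx'⟩
    have hp := Level.piece n j' i a' hi ha'
    rw [hp.levelSet_eq] at h
    exact ⟨_, _, _, hp, .piece n _ i b' hi hb', h, by rw [e]; ring⟩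

theorem StepsTo.unique (hr : ∀ n, 2 ≤ r n) {x y y' : ℝ} (h : StepsTo r s x y)
    (h' : StepsTo r s x y') : y = y' := by
  obtain ⟨n, j, a, b, ha, hb, hx, rfl⟩ := h
  obtain ⟨n', j', a', b', ha', hb', hx', rfl⟩ := h'
  obtain ⟨k, c, d, hc, hd, hxc, e⟩ := StepsTo.lift hr (le_max_left n n') ha hb hx
  obtain ⟨k', c', d', hc', hd', hxc', e'⟩ := StepsTo.lift hr (le_max_right n n') ha' hb' hx'
  obtain rfl := eq_of_mem_levelSet hr ⟨c, hc, hxc⟩ ⟨c', hc', hxc'⟩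
  rw [e, e', hc.left_unique hc', hd.left_unique hd']

theorem map_eq (hr : ∀ n, 2 ≤ r n) {n j : ℕ} {a b x : ℝ} (ha : Level r s n j a)
    (hb : Level r s n (j + 1) b) (hx : x ∈ Set.Ico a (a + width r n)) :
    map r s x = x - a + b := by
  have h : ∃ y, StepsTo r s x y := ⟨_, n, j, a, b, ha, hb, hx, rfl⟩
  rw [map, dif_pos h]
  exact StepsTo.unique hr h.choose_spec ⟨n, j, a, b, ha, hb, hx, rfl⟩

theorem iterate_map_eq (hr : ∀ n, 2 ≤ r n) {n j : ℕ} {a x : ℝ} (ha : Level r s n j a)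
    (hx : x ∈ Set.Ico a (a + width r n)) :
    ∀ {t : ℕ} {b : ℝ}, Level r s n (j + t) b → (map r s)^[t] x = x - a + b
  | 0, b, hb => by
    rw [add_zero] at hb
    rw [ha.left_unique hb]
    simp
  | t + 1, b, hb => by
    have := hb.lt_height
    obtain ⟨c, hc⟩ := exists_level (r := r) (s := s) (n := n) (j := j + t) (by omega)
    rw [Function.iterate_succ_apply', iterate_map_eq hr ha hx hc, map_eq hr hc hb]
    · ring
    · constructor <;> linarith [hx.1, hx.2]

theorem iterate_map_mem (hr : ∀ n, 2 ≤ r n) {n j t : ℕ} {x : ℝ} (h : x ∈ levelSet r s n j)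
    (ht : j + t < height r s n) : (map r s)^[t] x ∈ levelSet r s n (j + t) := by
  obtain ⟨a, ha, hx⟩ := h
  obtain ⟨b, hb⟩ := exists_level ht
  rw [iterate_map_eq hr ha hx hb]
  exact ⟨b, hb, by constructor <;> linarith [hx.1, hx.2]⟩

/-! ### The columns as sets -/

/-- The union of the levels of `C_n`. -/
def columnSet (r : ℕ → ℕ) (s : ℕ → ℕ → ℕ) (n : ℕ) : Set ℝ :=
  ⋃ j ∈ Finset.range (height r s n), levelSet r s n j

theorem mem_columnSet {n : ℕ} {x : ℝ} : x ∈ columnSet r s n ↔ ∃ j, x ∈ levelSet r s n j := by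
  simp only [columnSet, Finset.mem_range, Set.mem_iUnion, exists_prop]
  exact ⟨fun ⟨j, _, h⟩ => ⟨j, h⟩, fun ⟨j, h⟩ => ⟨j, lt_height_of_mem h, h⟩⟩

theorem measurableSet_columnSet (n : ℕ) : MeasurableSet (columnSet r s n) :=
  Finset.measurableSet_biUnion _ fun j _ => measurableSet_levelSet n j

theorem columnSet_mono (hr : ∀ n, 2 ≤ r n) : Monotone (columnSet r s) := by
  intro m n hmn x hx
  rw [mem_columnSet] at hx ⊢
  obtain ⟨j, hj⟩ := hx
  exact exists_mem_levelSet_of_le hr hmn hj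

theorem iUnion_columnSet (hr : ∀ n, 2 ≤ r n) (N : ℕ) :
    ⋃ n, columnSet r s (N + n) = space r s := by
  ext x
  rw [space_eq]
  simp only [Set.mem_iUnion, mem_columnSet]
  constructor
  · rintro ⟨n, j, h⟩
    exact ⟨_, j, h⟩
  · rintro ⟨n, j, h⟩
    exact ⟨n, exists_mem_levelSet_of_le hr (by omega) h⟩

theorem pairwiseDisjoint_levelSet (hr : ∀ n, 2 ≤ r n) (n : ℕ) (D : Set ℕ) :
    D.PairwiseDisjoint (levelSet r s n) := fun _ _ _ _ hij =>
  Set.disjoint_left.2 fun _ h h' => hij (eq_of_mem_levelSet hr h h')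

theorem volume_inter_columnSet (hr : ∀ n, 2 ≤ r n) {A : Set ℝ} (hA : MeasurableSet A) (n : ℕ) :
    volume (A ∩ columnSet r s n) =
      ∑ j ∈ Finset.range (height r s n), volume (A ∩ levelSet r s n j) := by
  rw [columnSet, Set.inter_iUnion₂, measure_biUnion_finset]
  · exact fun i hi j hj hij =>
      (pairwiseDisjoint_levelSet hr n _ hi hj hij).mono Set.inter_subset_right Set.inter_subset_right
  · exact fun j _ => hA.inter (measurableSet_levelSet n j)

theorem measure_apply_eq_iSup (hr : ∀ n, 2 ≤ r n) (N : ℕ) {A : Set ℝ} (hA : MeasurableSet A) :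
    measure r s A = ⨆ n, volume (A ∩ columnSet r s (N + n)) := by
  rw [measure, Measure.restrict_apply hA, ← iUnion_columnSet hr N, Set.inter_iUnion,
    Monotone.measure_iUnion]
  exact fun m n h => Set.inter_subset_inter_right _ (columnSet_mono hr (by omega))

theorem ae_mem_space : ∀ᵐ x ∂measure r s, x ∈ space r s :=
  ae_restrict_mem measurableSet_space

theorem ae_irrational : ∀ᵐ x ∂measure r s, Irrational x :=
  ae_restrict_of_ae (measure_eq_zero_iff_ae_notMem.1
    (Set.Countable.measure_zero (Set.countable_range ((↑) : ℚ → ℝ)) volume))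

/-! ### Reflecting the columns of a construction with palindromic spacers -/

/-- By symmetry of the spacers, what lies below subcolumn `i` is as tall as what lies above
subcolumn `r n - 1 - i`. The count above needs the last subcolumn to carry no spacers. -/
theorem subcolumnStart_reflect {n : ℕ} (hs : s n (r n - 1) = 0)
    (h : ∀ i < r n - 1, s n i = s n (r n - 2 - i)) :
    ∀ {i : ℕ}, i < r n → subcolumnStart r s n i + subcolumnStart r s n (r n - 1 - i) +
      height r s n = height r s (n + 1)
  | 0, hi => by
    obtain ⟨k, hk⟩ : ∃ k, r n = k + 1 := ⟨r n - 1, by omega⟩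
    rw [height_succ, hk, subcolumnStart_succ, subcolumnStart_zero]
    rw [hk] at hs
    simp only [Nat.add_sub_cancel, Nat.sub_zero] at hs ⊢
    omega
  | i + 1, hi => by
    have ih := subcolumnStart_reflect hs h (i := i) (by omega)
    have hi' := h i (by omega)
    have e : r n - 1 - i = (r n - 2 - i) + 1 := by omega
    rw [e, subcolumnStart_succ] at ih
    rw [subcolumnStart_succ, show r n - 1 - (i + 1) = r n - 2 - i by omega]
    omega

/-- The parameters are palindromic from stage `N` on, and no spacers are put on last subcolumns. -/
def PalindromicFrom (r : ℕ → ℕ) (s : ℕ → ℕ → ℕ) (N : ℕ) : Prop :=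
  ∀ n, N ≤ n → s n (r n - 1) = 0 ∧ ∀ i < r n - 1, s n i = s n (r n - 2 - i)

/-- The flip exchanging levels at `a` and `b` is `x ↦ a + b + width r m - x`. Passing to pieces `i`
and `r n - 1 - i` leaves this constant unchanged, so flips of different columns agree. -/
theorem PalindromicFrom.lift {N : ℕ} (hp : PalindromicFrom r s N) (hr : ∀ n, 2 ≤ r n)
    {m n j : ℕ} {a b x : ℝ} (hN : N ≤ m) (hmn : m ≤ n) (ha : Level r s m j a)
    (hb : Level r s m (height r s m - 1 - j) b) (hx : x ∈ Set.Ico a (a + width r m)) :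
    ∃ j' a' b', Level r s n j' a' ∧ Level r s n (height r s n - 1 - j') b' ∧
      x ∈ Set.Ico a' (a' + width r n) ∧ a + b + width r m = a' + b' + width r n := by
  induction n, hmn using Nat.le_induction with
  | base => exact ⟨j, a, b, ha, hb, hx, rfl⟩
  | succ n hn ih =>
    obtain ⟨j', a', b', ha', hb', hx', e⟩ := ih
    obtain ⟨i, hi, h⟩ := exists_mem_levelSet_succ hr ⟨a', ha', hx'⟩
    have h1 := Level.piece n j' i a' hi ha'
    have h2 := Level.piece n _ (r n - 1 - i) b' (by omega) hb'
    obtain ⟨hs0, hs⟩ := hp n (hN.trans hn)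
    have h3 := subcolumnStart_reflect hs0 hs hi
    have h4 := ha'.lt_height
    rw [show subcolumnStart r s n (r n - 1 - i) + (height r s n - 1 - j') =
      height r s (n + 1) - 1 - (subcolumnStart r s n i + j') by omega] at h2
    rw [h1.levelSet_eq] at h
    refine ⟨_, _, _, h1, h2, h, ?_⟩
    rw [e, ← mul_width_succ hr n, Nat.cast_sub (by omega), Nat.cast_sub (by omega)]
    push_cast
    ring

theorem PalindromicFrom.exists_reflection {N : ℕ} (hp : PalindromicFrom r s N)
    (hr : ∀ n, 2 ≤ r n) :
    ∃ ρ : ℝ → ℝ, Measurable ρ ∧ ∀ n, N ≤ n → ∀ j a b x, Level r s n j a →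
      Level r s n (height r s n - 1 - j) b → x ∈ Set.Ico a (a + width r n) →
      ρ x = a + b + width r n - x := by
  have hc : ∀ p : ℕ × ℕ, ∃ c : ℝ, ∀ a b, Level r s (N + p.1) p.2 a →
      Level r s (N + p.1) (height r s (N + p.1) - 1 - p.2) b →
      c = a + b + width r (N + p.1) := by
    intro p
    by_cases h : p.2 < height r s (N + p.1)
    · obtain ⟨a, ha⟩ := exists_level h
      obtain ⟨b, hb⟩ := exists_level (r := r) (s := s) (n := N + p.1)
        (j := height r s (N + p.1) - 1 - p.2) (by omega)
      exact ⟨a + b + width r (N + p.1), fun a' b' ha' hb' => by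
        rw [ha.left_unique ha', hb.left_unique hb']⟩
    · exact ⟨0, fun a b ha _ => absurd ha.lt_height h⟩
  choose c hc using hc
  obtain ⟨ρ, hρ, hρeq⟩ := exists_measurable_piecewise
    (fun p : ℕ × ℕ => levelSet r s (N + p.1) p.2) (fun p => measurableSet_levelSet _ _)
    (fun p x => c p - x) (fun p => measurable_const.sub measurable_id) (by
      rintro ⟨m, j⟩ ⟨m', j'⟩ - x ⟨⟨a, ha, hx⟩, ⟨a', ha', hx'⟩⟩
      have h := ha.lt_height
      have h' := ha'.lt_height
      simp only at ha ha' hx hx' h h' ⊢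
      obtain ⟨b, hb⟩ := exists_level (r := r) (s := s) (n := N + m)
        (j := height r s (N + m) - 1 - j) (by omega)
      obtain ⟨b', hb'⟩ := exists_level (r := r) (s := s) (n := N + m')
        (j := height r s (N + m') - 1 - j') (by omega)
      obtain ⟨k, e, f, he, hf, hxe, h1⟩ :=
        hp.lift hr (by omega) (le_max_left (N + m) (N + m')) ha hb hx
      obtain ⟨k', e', f', he', hf', hxe', h1'⟩ :=
        hp.lift hr (by omega) (le_max_right (N + m) (N + m')) ha' hb' hx'
      obtain rfl := eq_of_mem_levelSet hr ⟨e, he, hxe⟩ ⟨e', he', hxe'⟩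
      rw [hc (m, j) a b ha hb, hc (m', j') a' b' ha' hb', h1, h1', he.left_unique he',
        hf.left_unique hf'])
  refine ⟨ρ, hρ, fun n hn j a b x ha hb hx => ?_⟩
  obtain ⟨m, rfl⟩ := Nat.exists_eq_add_of_le hn
  rw [hρeq (m, j) ⟨a, ha, hx⟩, hc (m, j) a b ha hb]

/-- The reflection of all columns is an involution conjugating the transformation to its
inverse. -/
theorem PalindromicFrom.exists_conjugation {N : ℕ} (hp : PalindromicFrom r s N)
    (hr : ∀ n, 2 ≤ r n) :
    ∃ ρ : ℝ → ℝ, MeasurePreserving ρ (measure r s) (measure r s) ∧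
      (∀ᵐ x ∂measure r s, ρ (ρ x) = x) ∧
      ∀ᵐ x ∂measure r s, map r s (ρ (map r s x)) = ρ x := by
  obtain ⟨ρ, hρ, hρeq⟩ := hp.exists_reflection hr
  -- The flip sends a left endpoint to an excluded right endpoint; irrationality rules this out.
  have hmem : ∀ n, N ≤ n → ∀ j a b x, Level r s n j a → Level r s n (height r s n - 1 - j) b →
      x ∈ Set.Ico a (a + width r n) → Irrational x →
      ρ x ∈ Set.Ico b (b + width r n) := by
    intro n hn j a b x ha hb hx hirr
    rw [hρeq n hn j a b x ha hb hx]
    obtain ⟨q, rfl⟩ := ha.exists_eq_ratCast hr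
    have : (q : ℝ) ≠ x := fun h => hirr ⟨q, h⟩
    have := lt_of_le_of_ne hx.1 this
    constructor <;> linarith [hx.2]
  refine ⟨ρ, ⟨hρ, ?_⟩, ?_, ?_⟩
  · ext A hA
    rw [Measure.map_apply hρ hA, measure_apply_eq_iSup hr N (hρ hA), measure_apply_eq_iSup hr N hA]
    refine iSup_congr fun n => ?_
    rw [volume_inter_columnSet hr (hρ hA), volume_inter_columnSet hr hA,
      ← Finset.sum_range_reflect (fun j => volume (A ∩ levelSet r s (N + n) j))]
    refine Finset.sum_congr rfl fun j hj => ?_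
    have hj := Finset.mem_range.1 hj
    obtain ⟨a, ha⟩ := exists_level hj
    obtain ⟨b, hb⟩ := exists_level (r := r) (s := s) (n := N + n)
      (j := height r s (N + n) - 1 - j) (by omega)
    rw [ha.levelSet_eq, hb.levelSet_eq]
    have h1 : ρ ⁻¹' A ∩ Set.Ico a (a + width r (N + n)) =
        (fun x => a + b + width r (N + n) - x) ⁻¹' (A ∩ Set.Ioc b (b + width r (N + n))) := by
      ext x
      simp only [Set.mem_inter_iff, Set.mem_preimage]
      constructor
      · rintro ⟨hx, hx'⟩
        rw [hρeq _ (by omega) j a b x ha hb hx'] at hx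
        exact ⟨hx, by constructor <;> linarith [hx'.1, hx'.2]⟩
      · rintro ⟨hx, hx'⟩
        have hx' : x ∈ Set.Ico a (a + width r (N + n)) := by
          constructor <;> linarith [hx'.1, hx'.2]
        rw [hρeq _ (by omega) j a b x ha hb hx']
        exact ⟨hx, hx'⟩
    rw [h1, (Measure.measurePreserving_sub_left volume _).measure_preimage
      (hA.inter measurableSet_Ioc).nullMeasurableSet]
    -- A flipped half-open interval is closed on the other side, which changes it by a null set.
    exact measure_congr ((ae_eq_refl A).inter Ico_ae_eq_Ioc.symm)
  · filter_upwards [ae_mem_space, ae_irrational] with x hx hirr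
    obtain ⟨n, hn, j, ⟨a, ha, hxa⟩, hj⟩ := exists_mem_levelSet_add_lt hr hx N 0
    obtain ⟨b, hb⟩ := exists_level (r := r) (s := s) (n := n)
      (j := height r s n - 1 - j) (by omega)
    have h1 := hmem n hn j a b x ha hb hxa hirr
    have ha' : Level r s n (height r s n - 1 - (height r s n - 1 - j)) a := by
      rwa [show height r s n - 1 - (height r s n - 1 - j) = j by omega]
    rw [hρeq n hn _ b a _ hb ha' h1, hρeq n hn j a b x ha hb hxa]
    ring
  · filter_upwards [ae_mem_space, ae_irrational] with x hx hirr
    obtain ⟨n, hn, j, ⟨a, ha, hxa⟩, hj⟩ := exists_mem_levelSet_add_lt hr hx N 1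
    obtain ⟨b, hb⟩ := exists_level hj
    obtain ⟨d, hd⟩ := exists_level (r := r) (s := s) (n := n)
      (j := height r s n - 1 - (j + 1)) (by omega)
    obtain ⟨e, he⟩ := exists_level (r := r) (s := s) (n := n)
      (j := height r s n - 1 - j) (by omega)
    have he' : Level r s n (height r s n - 1 - (j + 1) + 1) e := by
      rwa [show height r s n - 1 - (j + 1) + 1 = height r s n - 1 - j by omega]
    have hMx : x - a + b ∈ Set.Ico b (b + width r n) := by
      constructor <;> linarith [hxa.1, hxa.2]
    have hirr' : Irrational (x - a + b) := by
      obtain ⟨p, rfl⟩ := ha.exists_eq_ratCast hr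
      obtain ⟨q, rfl⟩ := hb.exists_eq_ratCast hr
      exact (hirr.sub_ratCast p).add_ratCast q
    rw [map_eq hr ha hb hxa, map_eq hr hd he' (hmem n hn _ b d _ hb hd hMx hirr'),
      hρeq n hn _ b d _ hb hd hMx, hρeq n hn j a e x ha he hxa]
    ring

theorem isomorphicToInverse_of_palindromicFrom {X : Type*} [MeasurableSpace X] {μ : Measure X}
    {T : X → X} (hT : HasParameters μ T r s) {N : ℕ} (hp : PalindromicFrom r s N) :
    IsomorphicToInverse μ T := by
  obtain ⟨hT, hr, Φ, Ψ, hΦ, hΨ, hΨΦ, hΦΨ, hconj⟩ := hT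
  obtain ⟨ρ, hρ, hρρ, hMρM⟩ := hp.exists_conjugation hr
  set σ : X → X := Ψ ∘ ρ ∘ Φ with hσdef
  have hσ : MeasurePreserving σ μ μ := hΨ.comp (hρ.comp hΦ)
  have hσσ : ∀ᵐ x ∂μ, σ (σ x) = x := by
    have h1 := hΦ.quasiMeasurePreserving.ae hρρ
    have h2 := (hρ.comp hΦ).quasiMeasurePreserving.ae hΦΨ
    filter_upwards [h1, h2, hΨΦ] with x h1 h2 h3
    simp only [hσdef, Function.comp_apply] at h2 ⊢
    rw [h2, h1, h3]
  have hTσT : ∀ᵐ x ∂μ, T (σ (T x)) = σ x := by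
    have h1 := hΦ.quasiMeasurePreserving.ae hMρM
    have h2 := (hρ.comp (hΦ.comp hT)).quasiMeasurePreserving.ae hΦΨ
    have h3 := (hσ.comp hT).quasiMeasurePreserving.ae hconj
    have h4 := (hT.comp (hσ.comp hT)).quasiMeasurePreserving.ae hΨΦ
    filter_upwards [h1, h2, h3, h4, hconj] with x h1 h2 h3 h4 h5
    simp only [hσdef, Function.comp_apply] at h2 h3 h4 ⊢
    rw [h2] at h3
    rw [← h4, h3, h5, h1]
  -- From `T σ T = σ` and `σ σ = id`, the map `σ T σ` is inverse to `T`, and `σ` conjugates `T` to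
  -- it.
  refine ⟨σ ∘ T ∘ σ, ⟨hσ.comp (hT.comp hσ), ?_, ?_⟩, σ, σ, hσ, hσ, hσσ, hσσ, ?_⟩
  · filter_upwards [hTσT, hσσ] with x h1 h2
    simp [h1, h2]
  · filter_upwards [hσ.quasiMeasurePreserving.ae hTσT, hσσ] with x h1 h2
    simp [h1, h2]
  · filter_upwards [hσσ] with x h
    simp [h]

/-! ### The copies of `C_m` in a later column -/

/-- The positions in `C_{m+k}` at which the copies of `C_m` start. -/
def bases (r : ℕ → ℕ) (s : ℕ → ℕ → ℕ) (m : ℕ) : ℕ → Finset ℕ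
  | 0 => {0}
  | k + 1 => (Finset.range (r (m + k)) ×ˢ bases r s m k).image
      fun p => subcolumnStart r s (m + k) p.1 + p.2

theorem mem_bases_succ {m k p : ℕ} : p ∈ bases r s m (k + 1) ↔
    ∃ i < r (m + k), ∃ c ∈ bases r s m k, p = subcolumnStart r s (m + k) i + c := by
  simp only [bases, Finset.mem_image, Finset.mem_product, Finset.mem_range, Prod.exists]
  constructor
  · rintro ⟨i, c, ⟨hi, hc⟩, rfl⟩
    exact ⟨i, hi, c, hc, rfl⟩
  · rintro ⟨i, hi, c, hc, rfl⟩
    exact ⟨i, c, ⟨hi, hc⟩, rfl⟩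

theorem add_height_le_of_mem_bases {m : ℕ} :
    ∀ {k p : ℕ}, p ∈ bases r s m k → p + height r s m ≤ height r s (m + k)
  | 0, p, h => by
    obtain rfl : p = 0 := by simpa [bases] using h
    simp
  | k + 1, p, h => by
    obtain ⟨i, hi, c, hc, rfl⟩ := mem_bases_succ.1 h
    have h1 := add_height_le_of_mem_bases hc
    have h2 := subcolumnStart_add_le (r := r) (s := s) (n := m + k) hi
    rw [← add_assoc, height_succ]
    omega

theorem lt_height_of_mem_bases (hr : ∀ n, 2 ≤ r n) {m k p : ℕ} (h : p ∈ bases r s m k) :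
    p < height r s (m + k) := by
  have := add_height_le_of_mem_bases h
  have := lt_height (s := s) hr m
  omega

theorem injOn_subcolumnStart_add (hr : ∀ n, 2 ≤ r n) (m k : ℕ) :
    Set.InjOn (fun p : ℕ × ℕ => subcolumnStart r s (m + k) p.1 + p.2)
      {p | p.2 ∈ bases r s m k} := by
  rintro ⟨i, c⟩ hc ⟨i', c'⟩ hc' e
  simp only [Set.mem_ofPred_eq] at hc hc' e
  have h1 := lt_height_of_mem_bases hr hc
  have h2 := lt_height_of_mem_bases hr hc'
  obtain rfl := eq_of_subcolumnStart_add_eq e (by omega) (by omega)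
  obtain rfl : c = c' := by omega
  rfl

theorem card_bases_succ (hr : ∀ n, 2 ≤ r n) (m k : ℕ) :
    (bases r s m (k + 1)).card = r (m + k) * (bases r s m k).card := by
  rw [bases, Finset.card_image_of_injOn, Finset.card_product, Finset.card_range]
  exact (injOn_subcolumnStart_add hr m k).mono fun p hp => (Finset.mem_product.1 hp).2

theorem card_bases_pos (hr : ∀ n, 2 ≤ r n) (m : ℕ) : ∀ k, 0 < (bases r s m k).card
  | 0 => by simp [bases]
  | k + 1 => by
    rw [card_bases_succ hr]
    have := hr (m + k)
    exact Nat.mul_pos (by omega) (card_bases_pos hr m k)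

theorem card_bases_mul_width (hr : ∀ n, 2 ≤ r n) (m : ℕ) :
    ∀ k, (bases r s m k).card * width r (m + k) = width r m
  | 0 => by simp [bases]
  | k + 1 => by
    rw [card_bases_succ hr, ← card_bases_mul_width hr m k, ← mul_width_succ hr (m + k)]
    push_cast
    rw [add_assoc]
    ring

/-- `bases` peels off the outermost cut; here the innermost one is peeled off, locating a copy of
`C_m` inside a copy of `C_{m+1}`. -/
theorem exists_bases_split (hr : ∀ n, 2 ≤ r n) {m : ℕ} :
    ∀ {k p : ℕ}, p ∈ bases r s m (k + 1) →
      ∃ d ∈ bases r s (m + 1) k, ∃ i < r m, p = d + subcolumnStart r s m i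
  | 0, p, h => by
    obtain ⟨i, hi, c, hc, rfl⟩ := mem_bases_succ.1 h
    obtain rfl : c = 0 := by simpa [bases] using hc
    exact ⟨0, by simp [bases], i, hi, by simp⟩
  | k + 1, p, h => by
    obtain ⟨i, hi, c, hc, rfl⟩ := mem_bases_succ.1 h
    obtain ⟨d, hd, i', hi', rfl⟩ := exists_bases_split hr hc
    rw [show m + (k + 1) = m + 1 + k by omega] at hi ⊢
    exact ⟨_, mem_bases_succ.2 ⟨i, hi, d, hd, rfl⟩, i', hi', by ring⟩

theorem exists_mem_bases (hr : ∀ n, 2 ≤ r n) {m : ℕ} {x : ℝ} {b : ℕ}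
    (hb : x ∈ levelSet r s m b) :
    ∀ {k a : ℕ}, x ∈ levelSet r s (m + k) a → ∃ p ∈ bases r s m k, a = p + b
  | 0, a, ha => ⟨0, by simp [bases], by rw [eq_of_mem_levelSet hr hb ha, zero_add]⟩
  | k + 1, a, ha => by
    obtain ⟨a', ha'⟩ := exists_mem_levelSet_of_le hr (Nat.le_add_right m k) hb
    obtain ⟨i, hi, hx⟩ := exists_mem_levelSet_succ hr ha'
    obtain ⟨p, hp, rfl⟩ := exists_mem_bases hr hb ha'
    refine ⟨_, mem_bases_succ.2 ⟨i, hi, p, hp, rfl⟩, ?_⟩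
    rw [eq_of_mem_levelSet hr ha hx, add_assoc]

theorem levelSet_base_eq_iUnion (hr : ∀ n, 2 ≤ r n) (m : ℕ) :
    ∀ k, levelSet r s m 0 = ⋃ c ∈ bases r s m k, levelSet r s (m + k) c
  | 0 => by simp [bases]
  | k + 1 => by
    rw [levelSet_base_eq_iUnion hr m k]
    ext x
    simp only [Set.mem_iUnion, exists_prop]
    constructor
    · rintro ⟨c, hc, hx⟩
      obtain ⟨i, hi, hx'⟩ := exists_mem_levelSet_succ hr hx
      exact ⟨_, mem_bases_succ.2 ⟨i, hi, c, hc, rfl⟩, hx'⟩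
    · rintro ⟨p, hp, hx⟩
      obtain ⟨i, hi, c, hc, rfl⟩ := mem_bases_succ.1 hp
      exact ⟨c, hc, levelSet_piece_subset hr hi (lt_height_of_mem_bases hr hc) hx⟩

/-! ### Sparse copies -/

/-- From stage `N` on, every subcolumn except the last one is followed by at least as many spacers
as it has levels. -/
def SparseFrom (r : ℕ → ℕ) (s : ℕ → ℕ → ℕ) (N : ℕ) : Prop :=
  ∀ n, N ≤ n → ∀ i < r n - 1, height r s n ≤ s n i

/-- Between two copies of `C_m` there is a run of spacers from some stage `n ≥ m`, at least `height
r s n ≥ height r s m` of them, on top of the height of the first copy. -/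
theorem SparseFrom.add_two_mul_height_le {N : ℕ} (hsp : SparseFrom r s N) (hr : ∀ n, 2 ≤ r n)
    {m : ℕ} (hm : N ≤ m) : ∀ {k p q : ℕ}, p ∈ bases r s m k → q ∈ bases r s m k → p < q →
      p + 2 * height r s m ≤ q
  | 0, p, q, hp, hq, h => by
    simp only [bases, Finset.mem_singleton] at hp hq
    omega
  | k + 1, p, q, hp, hq, h => by
    obtain ⟨i, hi, c, hc, rfl⟩ := mem_bases_succ.1 hp
    obtain ⟨j, hj, d, hd, rfl⟩ := mem_bases_succ.1 hq
    rcases lt_trichotomy i j with hij | rfl | hij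
    · have h1 := subcolumnStart_add_le (r := r) (s := s) (n := m + k) hij
      have h2 := hsp (m + k) (by omega) i (by omega)
      have h3 := add_height_le_of_mem_bases hc
      have h4 := height_mono (s := s) hr (Nat.le_add_right m k)
      omega
    · have := hsp.add_two_mul_height_le hr hm hc hd (by omega)
      omega
    · have h1 := subcolumnStart_add_le (r := r) (s := s) (n := m + k) hij
      have h2 := lt_height_of_mem_bases hr hc
      have h3 := lt_height_of_mem_bases hr hd
      omega

theorem SparseFrom.eq_of_mem_bases {N : ℕ} (hsp : SparseFrom r s N) (hr : ∀ n, 2 ≤ r n)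
    {m : ℕ} (hm : N ≤ m) {k p q : ℕ} (hp : p ∈ bases r s m k) (hq : q ∈ bases r s m k)
    (h : p < q + 2 * height r s m) (h' : q < p + 2 * height r s m) : p = q := by
  rcases lt_trichotomy p q with hpq | hpq | hpq
  · have := hsp.add_two_mul_height_le hr hm hp hq hpq
    omega
  · exact hpq
  · have := hsp.add_two_mul_height_le hr hm hq hp hpq
    omega

/-- A translation moves a definite part of the copies away from all copies. -/
theorem SparseFrom.card_bases_le {N : ℕ} (hsp : SparseFrom r s N) (hr : ∀ n, 2 ≤ r n) {R : ℕ}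
    (hR : ∀ n, N ≤ n → r n ≤ R) {m : ℕ} (hm : N ≤ m) {e : ℕ} (he : 0 < e) :
    ∀ k, (bases r s m k).card ≤
      R * ((bases r s m k).filter fun c => c + e ∉ bases r s m k).card
  | 0 => by
    have h1 := hr m
    have h2 := hR m hm
    have : (bases r s m 0).filter (fun c => c + e ∉ bases r s m 0) = {0} := by
      ext c
      simp only [bases, Finset.mem_filter, Finset.mem_singleton]
      omega
    rw [this]
    simp [bases]
    omega
  | k + 1 => by
    have ih := hsp.card_bases_le hr hR hm he k
    rw [card_bases_succ hr]
    -- A short shift cannot cross the spacers between subcolumns, so escapes occur in each subcolumn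
    -- separately. A long shift pushes the whole last subcolumn out of the column, a proportion of
    -- at least `1 / R`.
    rcases lt_or_ge e (height r s (m + k)) with h | h
    · have hsub : (Finset.range (r (m + k)) ×ˢ
          (bases r s m k).filter fun c => c + e ∉ bases r s m k).image
            (fun p => subcolumnStart r s (m + k) p.1 + p.2) ⊆
          (bases r s m (k + 1)).filter fun c => c + e ∉ bases r s m (k + 1) := by
        intro x hx
        simp only [Finset.mem_image, Finset.mem_product, Finset.mem_range, Finset.mem_filter,
          Prod.exists] at hx ⊢
        obtain ⟨i, c, ⟨hi, hc, hce⟩, rfl⟩ := hx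
        refine ⟨mem_bases_succ.2 ⟨i, hi, c, hc, rfl⟩, fun hmem => hce ?_⟩
        obtain ⟨j, hj, d, hd, e'⟩ := mem_bases_succ.1 hmem
        have h1 := lt_height_of_mem_bases hr hc
        have h2 := lt_height_of_mem_bases hr hd
        rcases lt_trichotomy i j with hij | rfl | hij
        · have h3 := subcolumnStart_add_le (r := r) (s := s) (n := m + k) hij
          have h4 := hsp (m + k) (by omega) i (by omega)
          omega
        · obtain rfl : d = c + e := by omega
          exact hd
        · have h3 := subcolumnStart_add_le (r := r) (s := s) (n := m + k) hij
          omega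
      have hcard := Finset.card_le_card hsub
      rw [Finset.card_image_of_injOn, Finset.card_product, Finset.card_range] at hcard
      · calc r (m + k) * (bases r s m k).card
            ≤ r (m + k) * (R * _) := Nat.mul_le_mul_left _ ih
          _ = R * (r (m + k) * _) := Nat.mul_left_comm _ _ _
          _ ≤ _ := Nat.mul_le_mul_left _ hcard
      · exact (injOn_subcolumnStart_add hr m k).mono fun p hp =>
          (Finset.mem_filter.1 (Finset.mem_product.1 hp).2).1
    · have hr' := hr (m + k)
      have hsub : (bases r s m k).image
            (fun c => subcolumnStart r s (m + k) (r (m + k) - 1) + c) ⊆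
          (bases r s m (k + 1)).filter fun c => c + e ∉ bases r s m (k + 1) := by
        intro x hx
        simp only [Finset.mem_image, Finset.mem_filter] at hx ⊢
        obtain ⟨c, hc, rfl⟩ := hx
        refine ⟨mem_bases_succ.2 ⟨_, by omega, c, hc, rfl⟩, fun hmem => ?_⟩
        obtain ⟨j, hj, d, hd, e'⟩ := mem_bases_succ.1 hmem
        have h1 := lt_height_of_mem_bases hr hd
        have h2 := subcolumnStart_mono (r := r) (s := s) (m + k)
          (show j ≤ r (m + k) - 1 by omega)
        omega
      have hcard := Finset.card_le_card hsub
      rw [Finset.card_image_of_injective _ (add_right_injective _)] at hcard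
      exact Nat.mul_le_mul (hR _ (by omega)) hcard

/-- Two reflected copies of a set `C` in a set `D` overlap little if the translate of `C` by the
difference of the centres does. -/
theorem card_add_card_le_of_reflections {C D P Q : Finset ℕ} {e : ℕ} {o o' : ℤ} (ho : o' = o + e)
    (hP : P ⊆ C) (hQ : Q ⊆ C) (hPD : ∀ c ∈ P, ∃ j ∈ D, (j : ℤ) = o - c)
    (hQD : ∀ c ∈ Q, ∃ j ∈ D, (j : ℤ) = o' - c) :
    P.card + Q.card + (C.filter fun c => c + e ∉ C).card ≤ D.card + C.card := by
  have aux : ∀ (o : ℤ) (P : Finset ℕ), (∀ c ∈ P, ∃ j ∈ D, (j : ℤ) = o - c) →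
      P.image (fun c : ℕ => (o - c : ℤ).toNat) ⊆ D ∧
      (P.image fun c : ℕ => (o - c : ℤ).toNat).card = P.card := by
    intro o P h
    constructor
    · intro x hx
      obtain ⟨c, hc, rfl⟩ := Finset.mem_image.1 hx
      obtain ⟨j, hj, e⟩ := h c hc
      rwa [← e, Int.toNat_natCast]
    · refine Finset.card_image_of_injOn fun c hc c' hc' e => ?_
      obtain ⟨j, hj, h1⟩ := h c hc
      obtain ⟨j', hj', h2⟩ := h c' hc'
      omega
  obtain ⟨h1, h2⟩ := aux o P hPD
  obtain ⟨h3, h4⟩ := aux o' Q hQD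
  have h5 := Finset.card_union_add_card_inter (P.image fun c : ℕ => (o - c : ℤ).toNat)
    (Q.image fun c : ℕ => (o' - c : ℤ).toNat)
  have h6 := Finset.card_le_card (Finset.union_subset h1 h3)
  -- A common point `o - c = o' - c'` forces `c' = c + e`, so the overlap is counted by the `c` with
  -- `c` and `c + e` both in `C`.
  have h7 : (P.image (fun c : ℕ => (o - c : ℤ).toNat) ∩ Q.image fun c : ℕ => (o' - c : ℤ).toNat).card ≤
      (C.filter fun c => c + e ∈ C).card := by
    refine (Finset.card_le_card (t := (C.filter fun c => c + e ∈ C).image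
      fun c : ℕ => (o - c : ℤ).toNat) fun x hx => ?_).trans Finset.card_image_le
    obtain ⟨hx, hx'⟩ := Finset.mem_inter.1 hx
    obtain ⟨c, hc, rfl⟩ := Finset.mem_image.1 hx
    obtain ⟨c', hc', e'⟩ := Finset.mem_image.1 hx'
    obtain ⟨j, hj, h1⟩ := hPD c hc
    obtain ⟨j', hj', h2⟩ := hQD c' hc'
    obtain rfl : c' = c + e := by omega
    exact Finset.mem_image.2 ⟨c, Finset.mem_filter.2 ⟨hP hc, hQ hc'⟩, rfl⟩
  have h8 := Finset.card_filter_add_card_filter_not (s := C) (fun c => c + e ∈ C)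
  omega

theorem eq_reflection_of_strictAnti {l : ℕ} {σ : ℕ → ℕ} (hlt : ∀ i < l, σ i < l)
    (hanti : ∀ i j, i < j → j < l → σ j < σ i) {i : ℕ} (hi : i < l) : σ i = l - 1 - i := by
  have h1 : ∀ i, i < l → σ i + i ≤ l - 1 := by
    intro i
    induction i with
    | zero =>
      intro h
      have := hlt 0 h
      omega
    | succ i ih =>
      intro h
      have := ih (by omega)
      have := hanti i (i + 1) (by omega) h
      omega
  have h2 : ∀ d, d < l → d ≤ σ (l - 1 - d) := by
    intro d
    induction d with
    | zero => intro _; omega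
    | succ d ih =>
      intro h
      have := ih (by omega)
      have := hanti (l - 1 - (d + 1)) (l - 1 - d) (by omega) (by omega)
      omega
  have h3 := h1 i hi
  have h4 := h2 (l - 1 - i) (by omega)
  rw [show l - 1 - (l - 1 - i) = i by omega] at h4
  omega

/-- Subtracting the relations for `i` and `i + 1` cancels the heights and leaves the two spacer
counts. -/
theorem palindrome_of_subcolumnStart_add_eq {n : ℕ} {q : ℕ}
    (h : ∀ i < r n, subcolumnStart r s n i + subcolumnStart r s n (r n - 1 - i) = q) {i : ℕ}
    (hi : i < r n - 1) : s n i = s n (r n - 2 - i) := by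
  have h1 := h i (by omega)
  have h2 := h (i + 1) (by omega)
  rw [show r n - 1 - i = (r n - 2 - i) + 1 by omega, subcolumnStart_succ] at h1
  rw [show r n - 1 - (i + 1) = r n - 2 - i by omega, subcolumnStart_succ] at h2
  omega

/-! ### Maps reversing the orbits -/

/-- On the forward orbit of `x`, the map `φ` reverses the direction of time. -/
def ReversesOrbit (r : ℕ → ℕ) (s : ℕ → ℕ → ℕ) (φ : ℝ → ℝ) (x : ℝ) : Prop :=
  ∀ k, map r s (φ ((map r s)^[k + 1] x)) = φ ((map r s)^[k] x) ∧ φ ((map r s)^[k] x) ∈ space r s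

theorem ReversesOrbit.iterate {φ : ℝ → ℝ} {x : ℝ} (h : ReversesOrbit r s φ x) (k : ℕ) :
    ReversesOrbit r s φ ((map r s)^[k] x) := by
  intro l
  rw [← Function.iterate_add_apply, ← Function.iterate_add_apply, show l + 1 + k = l + k + 1 by ring]
  exact h (l + k)

theorem ReversesOrbit.eq_iterate {φ : ℝ → ℝ} {x : ℝ} (h : ReversesOrbit r s φ x) (c : ℕ) :
    ∀ t, φ ((map r s)^[c] x) = (map r s)^[t] (φ ((map r s)^[c + t] x))
  | 0 => rfl
  | t + 1 => by
    rw [h.eq_iterate c t, Function.iterate_succ_apply, ← add_assoc, (h (c + t)).1]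

/-- The image of the time-`H` point comes first in forward time; a column with `H` levels above it
contains the whole image segment, read backwards. -/
theorem ReversesOrbit.exists_mem_levelSet {φ : ℝ → ℝ} {x : ℝ} (h : ReversesOrbit r s φ x)
    (hr : ∀ n, 2 ≤ r n) (m H : ℕ) :
    ∃ k J, ∀ c ≤ H, φ ((map r s)^[c] x) ∈ levelSet r s (m + k) (J + (H - c)) := by
  obtain ⟨n, hn, J, hJ, hlt⟩ := exists_mem_levelSet_add_lt hr (h H).2 m H
  obtain ⟨k, rfl⟩ := Nat.exists_eq_add_of_le hn
  refine ⟨k, J, fun c hc => ?_⟩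
  rw [h.eq_iterate c (H - c), show c + (H - c) = H by omega]
  exact iterate_map_mem hr hJ (by omega)

theorem ReversesOrbit.exists_offset {φ : ℝ → ℝ} {x : ℝ} (h : ReversesOrbit r s φ x)
    (hr : ∀ n, 2 ≤ r n) {N : ℕ} (hsp : SparseFrom r s N) {m : ℕ} (hm : N ≤ m) :
    ∃ o : ℤ, ∀ c < height r s m, ∀ j, φ ((map r s)^[c] x) ∈ levelSet r s m j →
      (j : ℤ) = o - c := by
  obtain ⟨k, J, hJ⟩ := h.exists_mem_levelSet hr m (height r s m - 1)
  by_cases hex : ∃ c < height r s m, ∃ j, φ ((map r s)^[c] x) ∈ levelSet r s m j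
  · obtain ⟨c, hc, j, hj⟩ := hex
    refine ⟨j + c, fun c' hc' j' hj' => ?_⟩
    obtain ⟨p, hp, e⟩ := exists_mem_bases hr hj (hJ c (by omega))
    obtain ⟨p', hp', e'⟩ := exists_mem_bases hr hj' (hJ c' (by omega))
    have h1 := lt_height_of_mem hj
    have h2 := lt_height_of_mem hj'
    -- Both starts have the form `J + (h_m - 1) - (c + j)` with `c, j < h_m`, so they differ by less
    -- than `2 * h_m`.
    have := hsp.eq_of_mem_bases hr hm hp hp' (by omega) (by omega)
    omega
  · exact ⟨0, fun c hc j hj => absurd ⟨c, hc, j, hj⟩ hex⟩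

/-- If the copies of `C_n` in a copy of `C_{n+1}` are all sent to copies of `C_n` with the same
offset, then the spacers of stage `n` are palindromic. -/
theorem ReversesOrbit.palindrome {φ : ℝ → ℝ} {x : ℝ} (h : ReversesOrbit r s φ x)
    (hr : ∀ n, 2 ≤ r n) {N : ℕ} (hsp : SparseFrom r s N) {n : ℕ} (hn : N ≤ n) {o : ℤ}
    (ho : ∀ i < r n, ∃ c < height r s n, ∃ j : ℕ, (j : ℤ) = o - c ∧
      φ ((map r s)^[c] ((map r s)^[subcolumnStart r s n i] x)) ∈ levelSet r s n j) {i : ℕ}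
    (hi : i < r n - 1) : s n i = s n (r n - 2 - i) := by
  obtain ⟨k, J, hJ⟩ := h.exists_mem_levelSet hr (n + 1) (height r s (n + 1) - 1)
  rw [show n + 1 + k = n + (k + 1) by omega] at hJ
  have hlt : ∀ i < r n, subcolumnStart r s n i < height r s (n + 1) := fun i hi => by
    have := subcolumnStart_add_lt (r := r) (s := s) (u := 0) hi
      (by have := lt_height (s := s) hr n; omega)
    simpa using this
  -- The image of the `i`-th copy of `C_n` is subcolumn `l` of the copy of `C_{n+1}` starting at
  -- `d`.
  have key : ∀ i, ∃ d l : ℕ, i < r n → d ∈ bases r s (n + 1) k ∧ l < r n ∧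
      ((J + (height r s (n + 1) - 1) : ℕ) : ℤ) - o - subcolumnStart r s n i =
        d + subcolumnStart r s n l := by
    intro i
    by_cases hi : i < r n
    · obtain ⟨c, hc, j, hj, hmem⟩ := ho i hi
      rw [← Function.iterate_add_apply] at hmem
      have h1 := subcolumnStart_add_lt (r := r) (s := s) (u := c) hi (by omega)
      obtain ⟨p, hp, e⟩ := exists_mem_bases hr hmem (hJ (c + subcolumnStart r s n i) (by omega))
      obtain ⟨d, hd, l, hl, rfl⟩ := exists_bases_split hr hp
      exact ⟨d, l, fun _ => ⟨hd, hl, by omega⟩⟩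
    · exact ⟨0, 0, fun h => absurd h hi⟩
  choose d σ hdσ using key
  -- The whole segment is no longer than `C_{n+1}`, so it meets only one copy of it.
  have hd : ∀ i < r n, d i = d 0 := by
    intro i hi
    have h0 : 0 < r n := by omega
    obtain ⟨h1, h2, h3⟩ := hdσ i hi
    obtain ⟨h1', h2', h3'⟩ := hdσ 0 h0
    have := hlt i hi
    have := hlt 0 h0
    have := hlt _ h2
    have := hlt _ h2'
    exact hsp.eq_of_mem_bases hr (by omega) h1 h1' (by omega) (by omega)
  have hσ : ∀ i < r n, σ i = r n - 1 - i := fun i hi => by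
    refine eq_reflection_of_strictAnti (fun i hi => (hdσ i hi).2.1) (fun i j hij hj => ?_) hi
    by_contra! hle
    have h1 := (hdσ i (by omega)).2.2
    have h2 := (hdσ j hj).2.2
    rw [hd i (by omega)] at h1
    rw [hd j hj] at h2
    have h3 := subcolumnStart_mono (r := r) (s := s) n hle
    have h4 := subcolumnStart_add_le (r := r) (s := s) (n := n) hij
    have := lt_height (s := s) hr n
    omega
  refine palindrome_of_subcolumnStart_add_eq
    (q := subcolumnStart r s n 0 + subcolumnStart r s n (r n - 1)) (fun i hi => ?_) hi
  have h0 : 0 < r n := by omega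
  have h1 := (hdσ i hi).2.2
  have h2 := (hdσ 0 h0).2.2
  rw [hd i hi, hσ i hi] at h1
  rw [hσ 0 h0, Nat.sub_zero] at h2
  omega

/-- Points for which `φ` maps most copies of `C_m` into a small union of levels share their
offset. -/
theorem exists_common_offset (hr : ∀ n, 2 ≤ r n) {N R : ℕ} (hsp : SparseFrom r s N)
    (hR : ∀ n, N ≤ n → r n ≤ R) (k : ℕ) (φ : ℝ → ℝ) {D : Finset ℕ}
    (hD : 4 * R * D.card ≤ (4 * R + 1) * (bases r s N k).card) :
    ∃ o : ℤ, ∀ x, ReversesOrbit r s φ x → ∀ P ⊆ bases r s N k,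
      (bases r s N k).card + 4 * R * P.card > 4 * R * (bases r s N k).card →
      (∀ c ∈ P, ∃ j ∈ D, φ ((map r s)^[c] x) ∈ levelSet r s (N + k) j) →
      ∃ c < height r s (N + k), ∃ j : ℕ, (j : ℤ) = o - c ∧
        φ ((map r s)^[c] x) ∈ levelSet r s (N + k) j := by
  have hpos := card_bases_pos (s := s) hr N k
  have hR2 := (hr N).trans (hR N le_rfl)
  -- Multiplied by `4 * R`, the overlap bound has left side above `2 * (4 * R - 1) + 4 = 8 * R + 2`
  -- times `|C|` and right side at most `(4 * R + 1) + 4 * R = 8 * R + 1` times `|C|`.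
  have main : ∀ (P Q : Finset ℕ) (o o' : ℤ), P ⊆ bases r s N k → Q ⊆ bases r s N k →
      (bases r s N k).card + 4 * R * P.card > 4 * R * (bases r s N k).card →
      (bases r s N k).card + 4 * R * Q.card > 4 * R * (bases r s N k).card →
      (∀ c ∈ P, ∃ j ∈ D, (j : ℤ) = o - c) → (∀ c ∈ Q, ∃ j ∈ D, (j : ℤ) = o' - c) → ¬ o < o' := by
    intro P Q o o' hP hQ h1 h2 hPD hQD hlt
    obtain ⟨e, he⟩ := Int.le.dest hlt.le
    have h3 := hsp.card_bases_le hr hR le_rfl (e := e) (by omega) k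
    have h4 := card_add_card_le_of_reflections he.symm hP hQ hPD hQD
    have h5 := Nat.mul_le_mul_left (4 * R) h4
    simp only [Nat.mul_add, Nat.add_mul, Nat.mul_assoc] at h1 h2 h3 h5 hD
    omega
  by_cases hex : ∃ x, ReversesOrbit r s φ x ∧ ∃ P ⊆ bases r s N k,
      (bases r s N k).card + 4 * R * P.card > 4 * R * (bases r s N k).card ∧
      ∀ c ∈ P, ∃ j ∈ D, φ ((map r s)^[c] x) ∈ levelSet r s (N + k) j
  · obtain ⟨x, hx, P, hP, hcard, hPD⟩ := hex
    obtain ⟨o, ho⟩ := hx.exists_offset hr hsp (Nat.le_add_right N k)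
    refine ⟨o, fun y hy Q hQ hcard' hQD => ?_⟩
    obtain ⟨o', ho'⟩ := hy.exists_offset hr hsp (Nat.le_add_right N k)
    have h1 : ∀ c ∈ P, ∃ j ∈ D, (j : ℤ) = o - c := fun c hc => by
      obtain ⟨j, hj, hmem⟩ := hPD c hc
      exact ⟨j, hj, ho c (lt_height_of_mem_bases hr (hP hc)) j hmem⟩
    have h2 : ∀ c ∈ Q, ∃ j ∈ D, (j : ℤ) = o' - c := fun c hc => by
      obtain ⟨j, hj, hmem⟩ := hQD c hc
      exact ⟨j, hj, ho' c (lt_height_of_mem_bases hr (hQ hc)) j hmem⟩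
    obtain rfl : o = o' := le_antisymm (not_lt.1 (main Q P o' o hQ hP hcard' hcard h2 h1))
      (not_lt.1 (main P Q o o' hP hQ hcard hcard' h1 h2))
    have hne : Q.Nonempty := by
      rw [Finset.nonempty_iff_ne_empty]
      rintro rfl
      have := Nat.mul_le_mul_right (bases r s N k).card (show 1 ≤ 4 * R by omega)
      simp only [Finset.card_empty] at hcard'
      omega
    obtain ⟨c, hc⟩ := hne
    obtain ⟨j, hj, hmem⟩ := hQD c hc
    have hlt := lt_height_of_mem_bases hr (hQ hc)
    exact ⟨c, hlt, j, ho' c hlt j hmem, hmem⟩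
  · refine ⟨0, fun x hx P hP hcard hPD => ?_⟩
    exact absurd ⟨x, hx, P, hP, hcard, hPD⟩ hex

/-! ### Measures of unions of levels -/

theorem measure_levelSet {n j : ℕ} (h : j < height r s n) :
    measure r s (levelSet r s n j) = ENNReal.ofReal (width r n) := by
  rw [measure, Measure.restrict_apply (measurableSet_levelSet n j),
    Set.inter_eq_left.2 (levelSet_subset_space n j), volume_levelSet h]

theorem exists_translation (hr : ∀ n, 2 ≤ r n) {n c : ℕ} (hc : c < height r s n) :
    ∃ v : ℝ, (∀ x ∈ levelSet r s n 0, (map r s)^[c] x = x + v) ∧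
      (fun x => x + v) ⁻¹' levelSet r s n c = levelSet r s n 0 := by
  obtain ⟨a, ha⟩ := exists_level (r := r) (s := s) (n := n) (j := 0)
    (by have := lt_height (s := s) hr n; omega)
  obtain ⟨b, hb⟩ := exists_level hc
  refine ⟨b - a, fun x hx => ?_, ?_⟩
  · rw [ha.levelSet_eq] at hx
    rw [iterate_map_eq hr ha hx (by rwa [zero_add])]
    ring
  · rw [ha.levelSet_eq, hb.levelSet_eq, Set.preimage_add_const_Ico]
    congr 1 <;> ring

/-- On the base of a column the iterates up to the top are translations, so measurability of `map`
itself is not needed. -/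
theorem setOf_iterate_map_mem (hr : ∀ n, 2 ≤ r n) {n c : ℕ} (hc : c < height r s n) {B : Set ℝ}
    (hB : MeasurableSet B) :
    MeasurableSet {x ∈ levelSet r s n 0 | (map r s)^[c] x ∈ B} ∧
      measure r s {x ∈ levelSet r s n 0 | (map r s)^[c] x ∈ B} =
        measure r s (levelSet r s n c ∩ B) := by
  obtain ⟨v, hv, hpre⟩ := exists_translation hr hc
  have e : {x ∈ levelSet r s n 0 | (map r s)^[c] x ∈ B} =
      (fun x => x + v) ⁻¹' (levelSet r s n c ∩ B) := by
    rw [Set.preimage_inter, hpre]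
    ext x
    exact and_congr_right fun hx => by rw [hv x hx]; rfl
  have hm : MeasurableSet {x ∈ levelSet r s n 0 | (map r s)^[c] x ∈ B} := by
    rw [e]
    exact (measurable_add_const v) ((measurableSet_levelSet n c).inter hB)
  refine ⟨hm, ?_⟩
  rw [measure, Measure.restrict_apply hm,
    Measure.restrict_apply ((measurableSet_levelSet n c).inter hB),
    Set.inter_eq_left.2 fun x hx => levelSet_subset_space n 0 hx.1,
    Set.inter_eq_left.2 fun x hx => levelSet_subset_space n c hx.1, e,
    measure_preimage_add_right]

/-- Sets of finite measure are approximated by unions of levels of any sufficiently late column. -/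
theorem exists_approx_levels (hr : ∀ n, 2 ≤ r n) {A : Set ℝ} (hA : MeasurableSet A)
    (hfin : measure r s A ≠ ⊤) {ε : ENNReal} (hε : ε ≠ 0) :
    ∃ M, ∀ n, M ≤ n → ∃ D : Finset ℕ, (∀ j ∈ D, j < height r s n) ∧
      measure r s (A \ ⋃ j ∈ D, levelSet r s n j) ≤ ε ∧
      measure r s ((⋃ j ∈ D, levelSet r s n j) \ A) ≤ ε := by
  have hAs : MeasurableSet (A ∩ space r s) := hA.inter measurableSet_space
  rw [measure, Measure.restrict_apply hA] at hfin
  have hε2 : ε / 2 ≠ 0 := by simpa using hε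
  obtain ⟨K, hKA, hK, hAK⟩ := hAs.exists_isCompact_sdiff_lt hfin hε2
  obtain ⟨U, hAU, hU, -, hUA⟩ := hAs.exists_isOpen_sdiff_lt hfin hε
  obtain ⟨δ, hδ, hKU⟩ := hK.exists_thickening_subset_open hU (hKA.trans hAU)
  have hlim : Filter.Tendsto (fun n => volume (K \ columnSet r s n)) Filter.atTop (nhds 0) := by
    have h0 : ⋂ n, K \ columnSet r s n = ∅ := by
      ext x
      simp only [Set.mem_iInter, Set.mem_sdiff, Set.mem_empty_iff_false, iff_false]
      intro h
      have hx := (hKA (h 0).1).2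
      rw [← iUnion_columnSet hr 0] at hx
      obtain ⟨n, hn⟩ := Set.mem_iUnion.1 hx
      exact (h _).2 hn
    have := tendsto_measure_iInter_atTop (μ := volume) (s := fun n => K \ columnSet r s n)
      (fun n => (hK.measurableSet.diff (measurableSet_columnSet n)).nullMeasurableSet)
      (fun m n h => Set.sdiff_subset_sdiff_right (columnSet_mono hr h))
      ⟨0, ((measure_mono Set.sdiff_subset).trans_lt hK.measure_lt_top).ne⟩
    rwa [h0, measure_empty] at this
  have h1 := hlim.eventually (gt_mem_nhds (pos_iff_ne_zero.2 hε2))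
  have h2 := (tendsto_width hr).eventually (gt_mem_nhds hδ)
  obtain ⟨M, hM⟩ := Filter.eventually_atTop.1 (h1.and h2)
  refine ⟨M, fun n hn => ?_⟩
  obtain ⟨h1, h2⟩ := hM n hn
  classical
  -- The levels meeting `K` cover `K` up to the part outside the column, and being shorter than `δ`
  -- they stay inside `U`.
  set D := (Finset.range (height r s n)).filter fun j => ∃ x ∈ levelSet r s n j, x ∈ K with hD
  have hDlt : ∀ j ∈ D, j < height r s n := fun j hj =>
    Finset.mem_range.1 (Finset.mem_filter.1 hj).1
  have hE : MeasurableSet (⋃ j ∈ D, levelSet r s n j) :=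
    Finset.measurableSet_biUnion _ fun j _ => measurableSet_levelSet n j
  refine ⟨D, hDlt, ?_, ?_⟩
  · rw [measure, Measure.restrict_apply (hA.diff hE)]
    calc volume ((A \ ⋃ j ∈ D, levelSet r s n j) ∩ space r s)
        ≤ volume ((A ∩ space r s) \ K ∪ K \ columnSet r s n) := by
          refine measure_mono ?_
          rintro x ⟨⟨hxA, hxE⟩, hxs⟩
          by_cases hxK : x ∈ K
          · refine .inr ⟨hxK, fun hx => hxE ?_⟩
            obtain ⟨j, hj⟩ := mem_columnSet.1 hx
            exact Set.mem_biUnion (Finset.mem_filter.2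
              ⟨Finset.mem_range.2 (lt_height_of_mem hj), x, hj, hxK⟩) hj
          · exact .inl ⟨⟨hxA, hxs⟩, hxK⟩
      _ ≤ ε / 2 + ε / 2 := (measure_union_le _ _).trans (add_le_add hAK.le h1.le)
      _ = ε := ENNReal.add_halves ε
  · rw [measure, Measure.restrict_apply (hE.diff hA)]
    refine (measure_mono ?_).trans hUA.le
    rintro x ⟨⟨hxE, hxA⟩, hxs⟩
    refine ⟨hKU ?_, fun h => hxA h.1⟩
    simp only [Set.mem_iUnion, exists_prop] at hxE
    obtain ⟨j, hj, hx⟩ := hxE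
    obtain ⟨-, y, hy, hyK⟩ := Finset.mem_filter.1 hj
    obtain ⟨a, ha⟩ := exists_level (hDlt j hj)
    rw [ha.levelSet_eq] at hx hy
    refine Metric.mem_thickening_iff.2 ⟨y, hyK, ?_⟩
    rw [Real.dist_eq, abs_lt]
    constructor <;> linarith [hx.1, hx.2, hy.1, hy.2]

open Classical in
/-- Markov's inequality for the number of sets of a finite family containing a point. -/
theorem card_mul_measure_le {α : Type*} [MeasurableSpace α] (ν : Measure α) (C : Finset ℕ)
    {V : ℕ → Set α} (hV : ∀ c ∈ C, MeasurableSet (V c)) (K : ℕ) :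
    (C.card : ENNReal) * ν {x | C.card ≤ K * (C.filter fun c => x ∈ V c).card} ≤
      K * ∑ c ∈ C, ν (V c) := by
  have hmeas : ∀ c ∈ C, Measurable ((V c).indicator fun _ => (K : ENNReal)) := fun c hc =>
    measurable_const.indicator (hV c hc)
  have hf : ∀ x, ∑ c ∈ C, (V c).indicator (fun _ => (K : ENNReal)) x =
      ((K * (C.filter fun c => x ∈ V c).card : ℕ) : ENNReal) := by
    intro x
    simp only [Set.indicator_apply]
    rw [← Finset.sum_filter, Finset.sum_const, nsmul_eq_mul]
    push_cast
    ring
  have h := mul_meas_ge_le_lintegral₀ (μ := ν)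
    (f := fun x => ∑ c ∈ C, (V c).indicator (fun _ => (K : ENNReal)) x)
    (Finset.measurable_sum C hmeas).aemeasurable (C.card : ENNReal)
  rw [lintegral_finsetSum' C fun c hc => (hmeas c hc).aemeasurable] at h
  rw [Finset.mul_sum]
  convert h using 1
  · congr 3
    ext x
    rw [hf]
    exact Nat.cast_le.symm
  · exact Finset.sum_congr rfl fun c hc => by rw [lintegral_indicator_const (hV c hc)]

/-! ### Reversing maps force palindromic spacers -/

/-- Approximation fixes `D` for each late column, Markov's inequality bounds the bad passages, and a
passage through the next column with no bad part yields the common offset needed for the palindrome.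
-/
theorem exists_forall_palindrome (hr : ∀ n, 2 ≤ r n) {N R : ℕ} (hsp : SparseFrom r s N)
    (hR : ∀ n, N ≤ n → r n ≤ R) {φ ψ : ℝ → ℝ}
    (hφ : MeasurePreserving φ (measure r s) (measure r s))
    (hψ : MeasurePreserving ψ (measure r s) (measure r s))
    (hψφ : ∀ᵐ x ∂measure r s, ψ (φ x) = x) (hrev : ∀ᵐ x ∂measure r s, ReversesOrbit r s φ x) :
    ∃ M, ∀ n, M ≤ n → ∀ i, i < r n - 1 → s n i = s n (r n - 2 - i) := by
  have hR2 : (2 : ℝ) ≤ R := by exact_mod_cast (hr N).trans (hR N le_rfl)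
  have hh : ∀ n, 0 < height r s n := fun n => by have := lt_height (s := s) hr n; omega
  have hw := width_pos hr N
  -- Modulo null sets this is the image under `φ` of the base of `C_N`.
  set A' := ψ ⁻¹' levelSet r s N 0 with hA'
  have hA'm : MeasurableSet A' := hψ.measurable (measurableSet_levelSet N 0)
  have hA'ν : measure r s A' = ENNReal.ofReal (width r N) := by
    rw [hψ.measure_preimage (measurableSet_levelSet N 0).nullMeasurableSet,
      measure_levelSet (hh N)]
  -- This error gives `|D| ≤ (1 + 1 / (4 * R)) * |C|` and, after Markov with threshold `|C| / (4 *
  -- R)`, a bad set of measure at most `width r (n + 1) / 2`.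
  have hε : 0 < width r N / (8 * R ^ 2) := by positivity
  obtain ⟨M, hM⟩ := exists_approx_levels hr hA'm (hA'ν ▸ ENNReal.ofReal_ne_top)
    (ε := ENNReal.ofReal (width r N / (8 * R ^ 2))) (by simpa using hε)
  refine ⟨max N M, fun n hn i hi => ?_⟩
  obtain ⟨k, rfl⟩ := Nat.exists_eq_add_of_le ((le_max_left N M).trans hn)
  obtain ⟨D, hD, hA'E, hEA'⟩ := hM (N + k) ((le_max_right N M).trans hn)
  set E := ⋃ j ∈ D, levelSet r s (N + k) j with hEdef
  have hEm : MeasurableSet E :=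
    Finset.measurableSet_biUnion _ fun j _ => measurableSet_levelSet _ j
  set C := bases r s N k with hC
  have hCpos : (0 : ℝ) < C.card := by exact_mod_cast card_bases_pos hr N k
  have hCw : C.card * width r (N + k) = width r N := card_bases_mul_width hr N k
  have hwk := width_pos hr (N + k)
  have hDcard : 4 * R * D.card ≤ (4 * R + 1) * C.card := by
    have h1 : measure r s E = ENNReal.ofReal (D.card * width r (N + k)) := by
      rw [hEdef, measure_biUnion_finset (pairwiseDisjoint_levelSet hr _ _)
        fun j _ => measurableSet_levelSet _ j, Finset.sum_congr rfl fun j hj =>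
          measure_levelSet (hD j hj), Finset.sum_const, nsmul_eq_mul,
        ENNReal.ofReal_mul (by positivity), ENNReal.ofReal_natCast]
    have h2 : measure r s E ≤ ENNReal.ofReal (width r N + width r N / (8 * R ^ 2)) := by
      rw [ENNReal.ofReal_add hw.le hε.le, ← hA'ν, add_comm]
      refine (measure_mono fun x hx => ?_).trans ((measure_union_le (E \ A') A').trans
        (add_le_add_left hEA' _))
      by_cases h : x ∈ A'
      · exact .inr h
      · exact .inl ⟨hx, h⟩
    rw [h1, ENNReal.ofReal_le_ofReal_iff (by positivity), ← hCw] at h2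
    have h3 : (D.card : ℝ) ≤ C.card + C.card / (8 * R ^ 2) := by
      refine le_of_mul_le_mul_right (h2.trans_eq ?_) hwk
      ring
    have h4 : 4 * R * ((C.card : ℝ) / (8 * R ^ 2)) ≤ C.card := by
      have e : 4 * R * ((C.card : ℝ) / (8 * R ^ 2)) = C.card / (2 * R) := by
        field_simp
        norm_num
      rw [e]
      exact div_le_self hCpos.le (by linarith)
    have h5 : 4 * R * (D.card : ℝ) ≤ (4 * R + 1) * C.card := by
      have := mul_le_mul_of_nonneg_left h3 (show (0 : ℝ) ≤ 4 * R by positivity)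
      linarith
    exact_mod_cast h5
  obtain ⟨o, ho⟩ := exists_common_offset hr hsp hR k φ hDcard
  -- `V c` collects the passages whose visit to level `c` is sent outside `E`.
  set V : ℕ → Set ℝ := fun c => {x ∈ levelSet r s (N + k) 0 | (map r s)^[c] x ∈ (φ ⁻¹' E)ᶜ}
    with hV
  have hφE : MeasurableSet (φ ⁻¹' E)ᶜ := (hφ.measurable hEm).compl
  have hVm : ∀ c ∈ C, MeasurableSet (V c) := fun c hc =>
    (setOf_iterate_map_mem hr (lt_height_of_mem_bases hr hc) hφE).1
  have hsum : ∑ c ∈ C, measure r s (V c) ≤ ENNReal.ofReal (width r N / (8 * R ^ 2)) := by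
    calc ∑ c ∈ C, measure r s (V c)
        = ∑ c ∈ C, measure r s (levelSet r s (N + k) c ∩ (φ ⁻¹' E)ᶜ) :=
          Finset.sum_congr rfl fun c hc =>
            (setOf_iterate_map_mem hr (lt_height_of_mem_bases hr hc) hφE).2
      _ = measure r s (⋃ c ∈ C, levelSet r s (N + k) c ∩ (φ ⁻¹' E)ᶜ) := by
          rw [measure_biUnion_finset]
          · exact fun i hi j hj hij => (pairwiseDisjoint_levelSet hr _ _ hi hj hij).mono
              Set.inter_subset_left Set.inter_subset_left
          · exact fun c _ => (measurableSet_levelSet _ c).inter hφE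
      _ = measure r s (levelSet r s N 0 ∩ (φ ⁻¹' E)ᶜ) := by
          rw [← Set.iUnion₂_inter, ← levelSet_base_eq_iUnion hr N k]
      _ ≤ measure r s (φ ⁻¹' (A' \ E)) := by
          refine measure_mono_ae ?_
          filter_upwards [hψφ] with x hx hxA
          refine ⟨?_, hxA.2⟩
          change ψ (φ x) ∈ levelSet r s N 0
          rw [hx]
          exact hxA.1
      _ = measure r s (A' \ E) := hφ.measure_preimage (hA'm.diff hEm).nullMeasurableSet
      _ ≤ _ := hA'E
  classical
  set B := {x | C.card ≤ 4 * R * (C.filter fun c => x ∈ V c).card} with hB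
  have hBlt : measure r s B < ENNReal.ofReal (width r (N + k + 1)) := by
    by_contra! hle
    have h1 := card_mul_measure_le (measure r s) C hVm (4 * R)
    have h2 : ENNReal.ofReal (C.card * width r (N + k + 1)) ≤
        ENNReal.ofReal ((4 * R : ℕ) * (width r N / (8 * R ^ 2))) := by
      rw [ENNReal.ofReal_mul (by positivity), ENNReal.ofReal_mul (by positivity),
        ENNReal.ofReal_natCast, ENNReal.ofReal_natCast]
      refine (mul_le_mul_right hle _).trans ((le_of_eq ?_).trans
        (h1.trans (mul_le_mul_right hsum _)))
      congr!
    rw [ENNReal.ofReal_le_ofReal_iff (by positivity), ← hCw, ← mul_width_succ hr (N + k)] at h2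
    have hw1 := width_pos hr (N + k + 1)
    have hrR : (r (N + k) : ℝ) ≤ R := by exact_mod_cast hR (N + k) (Nat.le_add_right N k)
    have e : ((4 * R : ℕ) : ℝ) * (C.card * (r (N + k) * width r (N + k + 1)) / (8 * R ^ 2)) =
        (C.card * width r (N + k + 1)) * (r (N + k) / (2 * R)) := by
      push_cast
      field_simp
      ring
    rw [e] at h2
    have h3 : (r (N + k) : ℝ) / (2 * R) < 1 := by
      rw [div_lt_one (by positivity)]
      linarith
    have h4 := mul_lt_mul_of_pos_left h3 (mul_pos hCpos hw1)
    linarith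
  -- Replacing `B` by a measurable hull of equal measure avoids proving `B` measurable.
  set B' := toMeasurable (measure r s) B with hB'
  set c := subcolumnStart r s (N + k) with hc
  have hclt : ∀ i < r (N + k), c i < height r s (N + k + 1) := fun i hi => by
    simpa using subcolumnStart_add_lt (u := 0) hi (by have := hh (N + k); omega)
  -- Passages through `C_{n+1}` with some bad subpassage. The levels at the starts `c i` are
  -- disjoint, so `W` has measure at most that of `B`, less than the base of `C_{n+1}`.
  set W := ⋃ i ∈ Finset.range (r (N + k)),
    {x ∈ levelSet r s (N + k + 1) 0 | (map r s)^[c i] x ∈ B'} with hW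
  have hWlt : measure r s W < measure r s (levelSet r s (N + k + 1) 0) := by
    rw [measure_levelSet (hh _)]
    refine lt_of_le_of_lt ?_ hBlt
    calc measure r s W
        ≤ ∑ i ∈ Finset.range (r (N + k)), measure r s
          {x ∈ levelSet r s (N + k + 1) 0 | (map r s)^[c i] x ∈ B'} :=
          measure_biUnion_finset_le _ _
      _ = ∑ i ∈ Finset.range (r (N + k)), measure r s (levelSet r s (N + k + 1) (c i) ∩ B') :=
          Finset.sum_congr rfl fun i hi => (setOf_iterate_map_mem hr
            (hclt i (Finset.mem_range.1 hi)) (measurableSet_toMeasurable _ _)).2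
      _ = measure r s (⋃ i ∈ Finset.range (r (N + k)),
            levelSet r s (N + k + 1) (c i) ∩ B') := by
          rw [measure_biUnion_finset]
          · intro i _ j _ hij
            refine Disjoint.mono Set.inter_subset_left Set.inter_subset_left
              (Set.disjoint_left.2 fun x h h' => hij ?_)
            have := hh (N + k)
            exact eq_of_subcolumnStart_add_eq (u := 0) (u' := 0)
              (by simpa using eq_of_mem_levelSet hr h h') (by omega) (by omega)
          · exact fun i _ => (measurableSet_levelSet _ _).inter (measurableSet_toMeasurable _ _)
      _ ≤ measure r s B' :=
          measure_mono (Set.iUnion₂_subset fun i _ => Set.inter_subset_right)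
      _ = measure r s B := measure_toMeasurable B
  obtain ⟨x, hx, hxW, hxrev⟩ : ∃ x ∈ levelSet r s (N + k + 1) 0, x ∉ W ∧
      ReversesOrbit r s φ x := by
    by_contra! hcon
    refine hWlt.not_ge (measure_mono_ae ?_)
    filter_upwards [hrev] with x hx hxL
    by_contra hxW
    exact hcon x hxL hxW hx
  refine hxrev.palindrome hr hsp (Nat.le_add_right N k) (o := o) (fun i hi => ?_) hi
  have hy : (map r s)^[c i] x ∈ levelSet r s (N + k) 0 := by
    have := iterate_map_mem hr hx (t := c i) (by rw [zero_add]; exact hclt i hi)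
    rw [zero_add] at this
    exact levelSet_piece_subset hr hi (hh (N + k)) (by simpa using this)
  have hyB : (map r s)^[c i] x ∉ B := fun h => hxW
    (Set.mem_biUnion (Finset.mem_coe.2 (Finset.mem_range.2 hi))
      ⟨hx, subset_toMeasurable _ _ h⟩)
  set y := (map r s)^[c i] x with hydef
  refine ho y (hxrev.iterate (c i)) (C.filter fun c' => φ ((map r s)^[c'] y) ∈ E)
    (Finset.filter_subset _ _) ?_ ?_
  · have h1 : (C.filter fun c' => y ∈ V c') = C.filter fun c' => φ ((map r s)^[c'] y) ∉ E :=
      Finset.filter_congr fun c' _ => ⟨fun h => h.2, fun h => ⟨hy, h⟩⟩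
    have h2 := Finset.card_filter_add_card_filter_not (s := C)
      (fun c' => φ ((map r s)^[c'] y) ∈ E)
    have h3 := congrArg (4 * R * ·) h2
    simp only [hB, Set.mem_ofPred_eq, not_le, h1] at hyB
    simp only [Nat.mul_add] at h3
    rw [← hC]
    omega
  · intro c' hc'
    simpa [hEdef] using (Finset.mem_filter.1 hc').2

/-- An isomorphism to the inverse, read on the cutting and stacking model, reverses almost every
orbit. -/
theorem exists_reversing_map {X : Type*} [MeasurableSpace X] {μ : Measure X} {T : X → X}
    (hT : HasParameters μ T r s) (h : IsomorphicToInverse μ T) :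
    ∃ φ ψ : ℝ → ℝ, MeasurePreserving φ (measure r s) (measure r s) ∧
      MeasurePreserving ψ (measure r s) (measure r s) ∧
      (∀ᵐ x ∂measure r s, ψ (φ x) = x) ∧ ∀ᵐ x ∂measure r s, ReversesOrbit r s φ x := by
  obtain ⟨hTμ, hr, Φ, Ψ, hΦ, hΨ, hΨΦ, hΦΨ, hconj⟩ := hT
  obtain ⟨S, ⟨hS, hST, hTS⟩, α, β, hα, hβ, hβα, hαβ, hαT⟩ := h
  have hmap : ∀ᵐ y ∂measure r s, map r s y = Φ (T (Ψ y)) := by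
    filter_upwards [hΨ.quasiMeasurePreserving.ae hconj, hΦΨ] with y h1 h2
    rw [h1, h2]
  have hF : MeasurePreserving (fun y => Φ (T (Ψ y))) (measure r s) (measure r s) :=
    hΦ.comp (hTμ.comp hΨ)
  have hαΨ : MeasurePreserving (α ∘ Ψ) (measure r s) μ := hα.comp hΨ
  have hφ : MeasurePreserving (Φ ∘ α ∘ Ψ) (measure r s) (measure r s) := hΦ.comp hαΨ
  refine ⟨Φ ∘ α ∘ Ψ, Φ ∘ β ∘ Ψ, hφ, hΦ.comp (hβ.comp hΨ), ?_, ?_⟩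
  · filter_upwards [hαΨ.quasiMeasurePreserving.ae hΨΦ, hΨ.quasiMeasurePreserving.ae hβα, hΦΨ]
      with x h1 h2 h3
    simp only [Function.comp_apply] at h1 ⊢
    rw [h1, h2, h3]
  have hstep : ∀ᵐ x ∂measure r s, map r s ((Φ ∘ α ∘ Ψ) (map r s x)) = (Φ ∘ α ∘ Ψ) x := by
    filter_upwards [hmap, (hTμ.comp hΨ).quasiMeasurePreserving.ae hΨΦ,
      hΨ.quasiMeasurePreserving.ae hαT, (hS.comp hαΨ).quasiMeasurePreserving.ae hconj,
      hαΨ.quasiMeasurePreserving.ae hTS] with x h1 h2 h3 h4 h5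
    simp only [Function.comp_apply] at h2 h4 h5 ⊢
    rw [h1, h2, h3, ← h4, h5]
  -- `map` agrees almost everywhere with the measure-preserving `Φ ∘ T ∘ Ψ`, which lets
  -- almost-everywhere statements be pulled back along its iterates.
  have hiter : ∀ P : ℝ → Prop, (∀ᵐ x ∂measure r s, P x) →
      ∀ k, ∀ᵐ x ∂measure r s, P ((map r s)^[k] x) := by
    intro P hP k
    induction k with
    | zero => exact hP
    | succ k ih =>
      filter_upwards [hF.quasiMeasurePreserving.ae ih, hmap] with x h1 h2
      rwa [Function.iterate_succ_apply, h2]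
  filter_upwards [ae_all_iff.2 (hiter _ hstep),
    ae_all_iff.2 (hiter _ (hφ.quasiMeasurePreserving.ae ae_mem_space))] with x h1 h2
  intro k
  exact ⟨by rw [Function.iterate_succ_apply']; exact h1 k, h2 k⟩

end RankOne

theorem theorem6p1 {X : Type*} [MeasurableSpace X] (μ : Measure X) (T : X → X)
    (r : ℕ → ℕ) (s : ℕ → ℕ → ℕ) (hT : RankOne.HasParameters μ T r s)
    (hrs : RankOne.PartiallyBounded r s) :
    RankOne.IsomorphicToInverse μ T ↔
      ∃ N : ℕ, ∀ n, N ≤ n → ∀ i, i < r n - 1 → s n i = s n (r n - 2 - i) := by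
  obtain ⟨hlast, R, S, N, -, -, hb⟩ := hrs
  constructor
  · intro h
    obtain ⟨φ, ψ, hφ, hψ, hψφ, hrev⟩ := RankOne.exists_reversing_map hT h
    exact RankOne.exists_forall_palindrome hT.2.1 (fun n hn => (hb n hn).2.2)
      (fun n hn => (hb n hn).1.le) hφ hψ hψφ hrev
  · rintro ⟨M, hM⟩
    exact RankOne.isomorphicToInverse_of_palindromicFrom hT fun n hn => ⟨hlast n, hM n hn⟩
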